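/- Let $\mathcal H$ be an infinite-dimensional complex separable Hilbert space, $\mathcal B_1(\mathcal H)$ the trace class operators with the trace norm $\|T\|_1=\mathrm{Tr}\,|T|$, and $I\subseteq\mathbb R$ a non-degenerate interval. Let $\{\rho_\theta\}_{\theta\in I}$ be a family of states on $\mathcal H$ (positive trace class operators of trace one) with $\ker\rho_\theta=\{0\}$ for all $\theta\in I$, real analytic as a map $I\to\mathcal B_1(\mathcal H)$. Let $$\rho_\theta=\sum_k\lambda_k(\theta)P_k(\theta),\qquad P_k(\theta)f=\langle e_k(\theta),f\rangle\, e_k(\theta),$$ be its spectral decomposition, where for each $\theta\in I$ the $e_k(\theta)$ form an orthonormal basis of eigenvectors of $\rho_\theta$ with eigenvalues $\lambda_k(\theta)>0$ (listed with multiplicity), and $\lambda_k$, $e_k$ are differentiable on $I$. A prime denotes $d/d\theta$ (one-sided at an end point of $I$). Let $\theta\in I$ be such that $\{|\lambda_k'(\theta)/\lambda_k(\theta)|\}_k$ is bounded and $\{|\ln\lambda_k(\theta)|\,\|e_k'(\theta)\|\}_k$ is square-summable. Then, at this $\theta$: (i) $\sum_k|\lambda_k'|<\infty$ and $\sum_k\lambda_k\|e_k'\|<\infty$;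 the derivatives $\rho'$ and $P_k'$ exist in $\mathcal B_1(\mathcal H)$, and $$\rho'=\sum_k\lambda_k'P_k+\sum_k\lambda_kP_k',$$ both series converging in the trace norm. (ii) $\rho_\theta$ is strongly differentiable, and the series $$H=\sum_k\frac{\lambda_k'}{\lambda_k}P_k+\sum_k\ln\lambda_k\,P_k'$$ (the Boltzmann–von Neumann logarithmic derivative) converge strongly to bounded operators, with $$\|H\|\le\sup_k\left|\frac{\lambda_k'}{\lambda_k}\right|+2\Big(\sum_k\big(|\ln\lambda_k|\,\|e_k'\|\big)^2\Big)^{1/2}.$$ (iii) $H$ satisfies the Kubo–Mori–Bogoliubov equation $$\rho'=\int_0^1\rho^tH\rho^{1-t}\,dt,$$ the integrand being Bochner integrable in the operator norm. Moreover, if $\sum_k(|\ln\lambda_k|\,\|e_k'\|)^2$ converges uniformly on a compact set $K\subseteq I$, then $\sum_k\lambda_k\|e_k'\|$ converges uniformly on $K$. -/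

import Mathlib

open scoped InnerProductSpace ENNReal

namespace QuantumLD

/-! ### The trace class of a complex Hilbert space -/

section TraceNorm

variable {𝓗 : Type*} [NormedAddCommGroup 𝓗] [InnerProductSpace ℂ 𝓗] [CompleteSpace 𝓗]

/-- `∑ᵢ ⟨bᵢ, |T| bᵢ⟩ ∈ [0, ∞]` for a Hilbert basis `b`, where `|T| = (T* T)^{1/2}`. The summands
are nonnegative numbers, so each is equal to its absolute value. -/
noncomputable def traceAbs {ι : Type*} (b : HilbertBasis ι ℂ 𝓗) (T : 𝓗 →L[ℂ] 𝓗) : ℝ≥0∞ :=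
  ∑' i, ‖⟪b i, CFC.abs T (b i)⟫_ℂ‖ₑ

theorem parseval_enorm {𝓗 : Type*} [NormedAddCommGroup 𝓗] [InnerProductSpace ℂ 𝓗]
    {ι : Type*} (b : HilbertBasis ι ℂ 𝓗) (x : 𝓗) :
    ∑' i, ‖⟪b i, x⟫_ℂ‖ₑ ^ 2 = ‖x‖ₑ ^ 2 := by
  have h := b.hasSum_inner_mul_inner x x
  have h2 : HasSum (fun i => ‖⟪b i, x⟫_ℂ‖ ^ 2) (‖x‖ ^ 2) := by
    have := (Complex.hasSum_re h)
    rw [← inner_self_eq_norm_sq (𝕜 := ℂ) x]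
    convert this using 2 with i
    · have h4 := inner_mul_symm_re_eq_norm (𝕜 := ℂ) x (b i)
      rw [norm_mul, norm_inner_symm x, ← sq] at h4
      exact h4.symm
    · rfl
  have h3 := ENNReal.ofReal_tsum_of_nonneg (fun i => by positivity) h2.summable
  rw [h2.tsum_eq] at h3
  simp only [← ofReal_norm, ← ENNReal.ofReal_pow (norm_nonneg _)]
  exact h3.symm

theorem tsum_enorm_sq_adjoint {ι κ : Type*} (b : HilbertBasis ι ℂ 𝓗) (c : HilbertBasis κ ℂ 𝓗)
    (A : 𝓗 →L[ℂ] 𝓗) : ∑' i, ‖A (b i)‖ₑ ^ 2 = ∑' j, ‖(star A) (c j)‖ₑ ^ 2 := by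
  calc ∑' i, ‖A (b i)‖ₑ ^ 2 = ∑' i, ∑' j, ‖⟪c j, A (b i)⟫_ℂ‖ₑ ^ 2 := by
        simp_rw [parseval_enorm]
    _ = ∑' j, ∑' i, ‖⟪c j, A (b i)⟫_ℂ‖ₑ ^ 2 := ENNReal.tsum_comm
    _ = ∑' j, ∑' i, ‖⟪b i, (star A) (c j)⟫_ℂ‖ₑ ^ 2 := by
        refine tsum_congr fun j => tsum_congr fun i => ?_
        rw [ContinuousLinearMap.star_eq_adjoint, ContinuousLinearMap.adjoint_inner_right,
          ← ofReal_norm, ← ofReal_norm, norm_inner_symm]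
    _ = _ := by simp_rw [parseval_enorm]

theorem exists_sqrt_abs (T : 𝓗 →L[ℂ] 𝓗) :
    ∃ R : 𝓗 →L[ℂ] 𝓗, star R = R ∧ CFC.abs T = R * R :=
  ⟨CFC.sqrt (CFC.abs T), (CFC.sqrt_nonneg _).isSelfAdjoint.star_eq,
    (CFC.sqrt_mul_sqrt_self _ (CFC.abs_nonneg T)).symm⟩

theorem traceAbs_eq_of_sqrt {ι : Type*} (b : HilbertBasis ι ℂ 𝓗) {T R : 𝓗 →L[ℂ] 𝓗}
    (hR : star R = R) (hT : CFC.abs T = R * R) :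
    traceAbs b T = ∑' i, ‖R (b i)‖ₑ ^ 2 := by
  refine tsum_congr fun i => ?_
  have : ⟪b i, CFC.abs T (b i)⟫_ℂ = ⟪R (b i), R (b i)⟫_ℂ := by
    rw [hT, mul_apply_eq_comp]
    conv_lhs => rw [← hR]
    rw [hR, ← ContinuousLinearMap.adjoint_inner_left, ← ContinuousLinearMap.star_eq_adjoint, hR]
  rw [this, ← ofReal_norm, ← ofReal_norm, inner_self_eq_norm_sq_to_K]
  simp [ENNReal.ofReal_pow]

/-- The value does not depend on the Hilbert basis. -/
theorem traceAbs_basis_indep {ι κ : Type*} (b : HilbertBasis ι ℂ 𝓗) (c : HilbertBasis κ ℂ 𝓗)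
    (T : 𝓗 →L[ℂ] 𝓗) : traceAbs b T = traceAbs c T := by
  obtain ⟨R, hR, hT⟩ := exists_sqrt_abs T
  rw [traceAbs_eq_of_sqrt b hR hT, traceAbs_eq_of_sqrt c hR hT, tsum_enorm_sq_adjoint b c, hR]

/-- An approximate polar decomposition. -/
theorem exists_approx_polar (T : 𝓗 →L[ℂ] 𝓗) {ε : ℝ} (hε : 0 < ε) :
    ∃ U : 𝓗 →L[ℂ] 𝓗, ‖U‖ ≤ 1 ∧ ‖star U‖ ≤ 1 ∧ ‖T - U * CFC.abs T‖ ≤ ε ∧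
      ‖CFC.abs T - star U * T‖ ≤ ε := by
  set S := CFC.abs T with hS
  have hS0 : 0 ≤ S := CFC.abs_nonneg T
  have hSp : S.IsPositive := (ContinuousLinearMap.nonneg_iff_isPositive S).1 hS0
  have hSs : star S = S := hS0.isSelfAdjoint.star_eq
  have hSS : S * S = star T * T := CFC.abs_mul_abs T
  have hnorm : ∀ x, ‖T x‖ = ‖S x‖ := by
    intro x
    have h1 : ⟪T x, T x⟫_ℂ = ⟪S x, S x⟫_ℂ := by
      rw [← ContinuousLinearMap.adjoint_inner_right, ← ContinuousLinearMap.adjoint_inner_right,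
        ← ContinuousLinearMap.star_eq_adjoint, ← ContinuousLinearMap.star_eq_adjoint,
        ← mul_apply_eq_comp, ← mul_apply_eq_comp, hSs, hSS]
    rw [@norm_eq_sqrt_re_inner ℂ, @norm_eq_sqrt_re_inner ℂ _ _ _ _ (S x), h1]
  have hexp : ∀ x, ‖S x‖ ^ 2 + ε ^ 2 * ‖x‖ ^ 2 ≤ ‖(S + (ε : ℂ) • 1) x‖ ^ 2 := by
    intro x
    have h1 : (S + (ε : ℂ) • 1) x = S x + (ε : ℂ) • x := by simp
    have h2 := hSp.re_inner_nonneg_left x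
    rw [h1, @norm_add_sq ℂ, norm_smul, inner_smul_right]
    have h3 : RCLike.re ((ε : ℂ) * ⟪S x, x⟫_ℂ) = ε * RCLike.re ⟪S x, x⟫_ℂ := by
      simp
    rw [h3, Complex.norm_real, Real.norm_of_nonneg hε.le, mul_pow]
    nlinarith [mul_nonneg hε.le h2]
  have hunit : IsUnit (S + (ε : ℂ) • (1 : 𝓗 →L[ℂ] 𝓗)) := by
    refine ContinuousLinearMap.isUnit_of_forall_le_norm_inner_map _ (c := ⟨ε, hε.le⟩) hε ?_
    intro x
    have h2 := hSp.re_inner_nonneg_left x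
    refine le_trans ?_ (RCLike.re_le_norm _)
    have h1 : (S + (ε : ℂ) • 1) x = S x + (ε : ℂ) • x := by simp
    rw [h1, inner_add_left, inner_smul_left, map_add]
    have h3 : RCLike.re ((starRingEnd ℂ) (ε : ℂ) * ⟪x, x⟫_ℂ) = ε * ‖x‖ ^ 2 := by
      rw [Complex.conj_ofReal, ← inner_self_eq_norm_sq (𝕜 := ℂ) x]
      simp
    rw [h3]
    refine le_of_eq_of_le (mul_comm _ _) ?_
    exact le_add_of_nonneg_left h2
  obtain ⟨G, hG1, hG2⟩ := isUnit_iff_exists.1 hunit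
  have hGs : star G = G := by
    have h1 : star G * (S + (ε : ℂ) • 1) = 1 := by
      have := congrArg star hG1
      simpa [hSs] using this
    calc star G = star G * ((S + (ε : ℂ) • 1) * G) := by rw [hG1, mul_one]
      _ = G := by rw [← mul_assoc, h1, one_mul]
  have hbd : ∀ x, ‖S (G x)‖ ≤ ‖x‖ := by
    intro x
    have h1 := hexp (G x)
    have h3 : (S + (ε : ℂ) • 1) (G x) = x := by
      simpa using DFunLike.congr_fun hG1 x
    rw [h3] at h1
    have h2 : 0 ≤ ε ^ 2 * ‖G x‖ ^ 2 := by positivity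
    exact le_of_sq_le_sq (by linarith) (norm_nonneg x)
  have hU : ‖T * G‖ ≤ 1 := by
    refine ContinuousLinearMap.opNorm_le_bound _ zero_le_one fun x => ?_
    rw [mul_apply_eq_comp, hnorm, one_mul]
    exact hbd x
  have hGS : G * S = 1 - (ε : ℂ) • G := by
    rw [mul_add, mul_smul_comm, mul_one] at hG2
    exact eq_sub_of_add_eq hG2
  have hSG : S * G = 1 - (ε : ℂ) • G := by
    rw [add_mul, smul_mul_assoc, one_mul] at hG1
    exact eq_sub_of_add_eq hG1
  have hεn : ‖(ε : ℂ)‖ = ε := by rw [Complex.norm_real, Real.norm_of_nonneg hε.le]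
  refine ⟨T * G, hU, by rwa [norm_star], ?_, ?_⟩
  · have : T - T * G * S = (ε : ℂ) • (T * G) := by
      rw [mul_assoc, hGS, mul_sub, mul_one, mul_smul_comm]; abel
    rw [this, norm_smul, hεn]
    exact mul_le_of_le_one_right hε.le hU
  · have : S - star (T * G) * T = (ε : ℂ) • (S * G) := by
      rw [star_mul, mul_assoc, ← hSS, hGs, ← mul_assoc, hGS, hSG, sub_mul, one_mul, smul_mul_assoc,
        hGS]; abel
    rw [this, norm_smul, hεn]
    refine mul_le_of_le_one_right hε.le ?_
    refine ContinuousLinearMap.opNorm_le_bound _ zero_le_one fun x => ?_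
    rw [one_mul]
    exact hbd x

theorem enorm_inner_basis_le {𝓗 : Type*} [NormedAddCommGroup 𝓗] [InnerProductSpace ℂ 𝓗]
    {ι : Type*} (b : HilbertBasis ι ℂ 𝓗) (A : 𝓗 →L[ℂ] 𝓗) {ε : ℝ}
    (hA : ‖A‖ ≤ ε) (i : ι) : ‖⟪b i, A (b i)⟫_ℂ‖ₑ ≤ ENNReal.ofReal ε := by
  rw [← ofReal_norm]
  refine ENNReal.ofReal_le_ofReal ?_
  refine (norm_inner_le_norm _ _).trans ?_
  have h1 : ‖b i‖ = 1 := b.orthonormal.1 i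
  rw [h1, one_mul]
  refine (A.le_opNorm _).trans ?_
  rw [h1, mul_one]
  exact hA

theorem le_of_forall_eps_card {a c : ℝ≥0∞} (n : ℕ)
    (h : ∀ ε : ℝ, 0 < ε → a ≤ c + n * ENNReal.ofReal ε) : a ≤ c := by
  refine ge_of_tendsto (f := fun ε : ℝ => c + n * ENNReal.ofReal ε) (x := nhdsWithin 0 (Set.Ioi 0))
    ?_ ?_
  · have h1 : Filter.Tendsto (fun ε : ℝ => c + n * ENNReal.ofReal ε) (nhds 0)
        (nhds (c + n * ENNReal.ofReal 0)) := by
      refine tendsto_const_nhds.add (ENNReal.Tendsto.const_mul ?_ (Or.inr (by simp)))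
      exact (ENNReal.continuous_ofReal.tendsto 0)
    simpa using h1.mono_left nhdsWithin_le_nhds
  · exact Filter.eventually_of_mem self_mem_nhdsWithin fun ε hε => h ε hε

theorem tsum_enorm_inner_le_traceAbs {ι : Type*} (b : HilbertBasis ι ℂ 𝓗) (K T : 𝓗 →L[ℂ] 𝓗)
    (hK : ‖K‖ ≤ 1) : ∑' i, ‖⟪b i, K (T (b i))⟫_ℂ‖ₑ ≤ traceAbs b T := by
  obtain ⟨R, hR, hT⟩ := exists_sqrt_abs T
  rw [ENNReal.tsum_eq_iSup_sum]
  refine iSup_le fun F => le_of_forall_eps_card F.card fun ε hε => ?_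
  obtain ⟨U, hU, -, hTU, -⟩ := exists_approx_polar T hε
  set V := K * U with hV
  have hV1 : ‖V‖ ≤ 1 := (norm_mul_le K U).trans (mul_le_one₀ hK (norm_nonneg _) hU)
  have hKD : ‖K * (T - U * CFC.abs T)‖ ≤ ε :=
    (norm_mul_le _ _).trans ((mul_le_of_le_one_left (norm_nonneg _) hK).trans hTU)
  have hpt : ∀ i, ‖⟪b i, K (T (b i))⟫_ℂ‖ₑ ≤
      2⁻¹ * (‖(R * star V) (b i)‖ₑ ^ 2 + ‖R (b i)‖ₑ ^ 2) + ENNReal.ofReal ε := by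
    intro i
    have h1 : K (T (b i)) = V (R (R (b i))) + (K * (T - U * CFC.abs T)) (b i) := by
      simp [hV, hT]
    have h2 : ⟪b i, V (R (R (b i)))⟫_ℂ = ⟪(R * star V) (b i), R (b i)⟫_ℂ := by
      rw [← ContinuousLinearMap.adjoint_inner_right, ← ContinuousLinearMap.star_eq_adjoint,
        star_mul, star_star, hR, mul_apply_eq_comp]
      rfl
    rw [h1, inner_add_right]
    refine (enorm_add_le _ _).trans (add_le_add ?_ (enorm_inner_basis_le b _ hKD i))
    rw [h2]
    simp only [← ofReal_norm]
    rw [← ENNReal.ofReal_pow (norm_nonneg _), ← ENNReal.ofReal_pow (norm_nonneg _),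
      ← ENNReal.ofReal_add (by positivity) (by positivity),
      show (2⁻¹ : ℝ≥0∞) = ENNReal.ofReal 2⁻¹ by
        rw [ENNReal.ofReal_inv_of_pos (by norm_num)]; simp,
      ← ENNReal.ofReal_mul (by norm_num)]
    refine ENNReal.ofReal_le_ofReal ((norm_inner_le_norm _ _).trans ?_)
    nlinarith [sq_nonneg (‖(R * star V) (b i)‖ - ‖R (b i)‖)]
  have hRV : ∑' i, ‖(R * star V) (b i)‖ₑ ^ 2 ≤ traceAbs b T := by
    rw [traceAbs_eq_of_sqrt b hR hT, tsum_enorm_sq_adjoint b b]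
    refine ENNReal.tsum_le_tsum fun i => ?_
    rw [star_mul, star_star, hR, mul_apply_eq_comp]
    gcongr
    rw [← ofReal_norm, ← ofReal_norm]
    refine ENNReal.ofReal_le_ofReal ((V.le_opNorm _).trans ?_)
    exact mul_le_of_le_one_left (norm_nonneg _) hV1
  calc ∑ i ∈ F, ‖⟪b i, K (T (b i))⟫_ℂ‖ₑ
      ≤ ∑ i ∈ F, (2⁻¹ * (‖(R * star V) (b i)‖ₑ ^ 2 + ‖R (b i)‖ₑ ^ 2) + ENNReal.ofReal ε) :=
        Finset.sum_le_sum fun i _ => hpt i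
    _ = 2⁻¹ * (∑ i ∈ F, ‖(R * star V) (b i)‖ₑ ^ 2 + ∑ i ∈ F, ‖R (b i)‖ₑ ^ 2)
          + F.card * ENNReal.ofReal ε := by
        rw [Finset.sum_add_distrib, ← Finset.mul_sum, Finset.sum_add_distrib]; simp
    _ ≤ 2⁻¹ * (traceAbs b T + traceAbs b T) + F.card * ENNReal.ofReal ε := by
        gcongr
        · exact (ENNReal.sum_le_tsum F).trans hRV
        · rw [traceAbs_eq_of_sqrt b hR hT]
          exact ENNReal.sum_le_tsum F
    _ = traceAbs b T + F.card * ENNReal.ofReal ε := by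
        rw [← two_mul, ← mul_assoc, ENNReal.inv_mul_cancel (by simp) (by simp), one_mul]

/-- It is enough to test against the contractions `K`. -/
theorem traceAbs_le_of_forall {ι : Type*} (b : HilbertBasis ι ℂ 𝓗) (T : 𝓗 →L[ℂ] 𝓗) {c : ℝ≥0∞}
    (h : ∀ K : 𝓗 →L[ℂ] 𝓗, ‖K‖ ≤ 1 → ∑' i, ‖⟪b i, K (T (b i))⟫_ℂ‖ₑ ≤ c) :
    traceAbs b T ≤ c := by
  rw [traceAbs, ENNReal.tsum_eq_iSup_sum]
  refine iSup_le fun F => le_of_forall_eps_card F.card fun ε hε => ?_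
  obtain ⟨U, -, hU, -, hTU⟩ := exists_approx_polar T hε
  have hpt : ∀ i, ‖⟪b i, CFC.abs T (b i)⟫_ℂ‖ₑ ≤
      ‖⟪b i, (star U) (T (b i))⟫_ℂ‖ₑ + ENNReal.ofReal ε := by
    intro i
    have h1 : CFC.abs T (b i) = (star U) (T (b i)) + (CFC.abs T - star U * T) (b i) := by simp
    rw [h1, inner_add_right]
    exact (enorm_add_le _ _).trans (add_le_add le_rfl (enorm_inner_basis_le b _ hTU i))
  calc ∑ i ∈ F, ‖⟪b i, CFC.abs T (b i)⟫_ℂ‖ₑ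
      ≤ ∑ i ∈ F, (‖⟪b i, (star U) (T (b i))⟫_ℂ‖ₑ + ENNReal.ofReal ε) :=
        Finset.sum_le_sum fun i _ => hpt i
    _ = ∑ i ∈ F, ‖⟪b i, (star U) (T (b i))⟫_ℂ‖ₑ + F.card * ENNReal.ofReal ε := by
        rw [Finset.sum_add_distrib]; simp
    _ ≤ c + F.card * ENNReal.ofReal ε := by
        gcongr
        exact (ENNReal.sum_le_tsum F).trans (h _ hU)

theorem traceAbs_add_le {ι : Type*} (b : HilbertBasis ι ℂ 𝓗) (S T : 𝓗 →L[ℂ] 𝓗) :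
    traceAbs b (S + T) ≤ traceAbs b S + traceAbs b T := by
  refine traceAbs_le_of_forall b _ fun K hK => ?_
  refine le_trans ?_ (add_le_add (tsum_enorm_inner_le_traceAbs b K S hK)
    (tsum_enorm_inner_le_traceAbs b K T hK))
  rw [← ENNReal.tsum_add]
  refine ENNReal.tsum_le_tsum fun i => ?_
  rw [add_apply, map_add, inner_add_right]
  exact enorm_add_le _ _

theorem traceAbs_smul {ι : Type*} (b : HilbertBasis ι ℂ 𝓗) (c : ℂ) (T : 𝓗 →L[ℂ] 𝓗) :
    traceAbs b (c • T) = ‖c‖ₑ * traceAbs b T := by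
  rw [traceAbs, traceAbs, CFC.abs_smul, ← ENNReal.tsum_mul_left]
  refine tsum_congr fun i => ?_
  rw [smul_apply, inner_smul_right_eq_smul, enorm_smul, enorm_norm]

theorem traceAbs_zero {ι : Type*} (b : HilbertBasis ι ℂ 𝓗) :
    traceAbs b (0 : 𝓗 →L[ℂ] 𝓗) = 0 := by
  simp [traceAbs]

theorem eq_zero_of_traceAbs {ι : Type*} (b : HilbertBasis ι ℂ 𝓗) {T : 𝓗 →L[ℂ] 𝓗}
    (h : traceAbs b T = 0) : T = 0 := by
  obtain ⟨R, hR, hT⟩ := exists_sqrt_abs T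
  rw [traceAbs_eq_of_sqrt b hR hT, ENNReal.tsum_eq_zero] at h
  have hR0 : R = 0 := by
    ext x
    have h1 := parseval_enorm b (R x)
    have h2 : ∀ i, ⟪b i, R x⟫_ℂ = 0 := by
      intro i
      rw [← ContinuousLinearMap.adjoint_inner_left, ← ContinuousLinearMap.star_eq_adjoint, hR]
      have h3 : R (b i) = 0 := by simpa using h i
      rw [h3, inner_zero_left]
    simp only [h2] at h1
    simpa using h1.symm
  rw [hR0, mul_zero] at hT
  exact CFC.abs_eq_zero_iff.1 hT

theorem traceAbs_rankOne_lt_top {ι : Type*} (b : HilbertBasis ι ℂ 𝓗) (u v : 𝓗) :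
    traceAbs b (InnerProductSpace.rankOne ℂ u v) < ⊤ := by
  refine lt_of_le_of_lt (b := ‖u‖ₑ ^ 2 + ‖v‖ₑ ^ 2) ?_ (by simp)
  refine traceAbs_le_of_forall b _ fun K hK => ?_
  have hKu : ‖K u‖ₑ ^ 2 ≤ ‖u‖ₑ ^ 2 := by
    gcongr
    rw [← ofReal_norm, ← ofReal_norm]
    exact ENNReal.ofReal_le_ofReal
      ((K.le_opNorm _).trans (mul_le_of_le_one_left (norm_nonneg _) hK))
  refine le_trans ?_ (add_le_add hKu le_rfl)
  rw [← parseval_enorm b (K u), ← parseval_enorm b v, ← ENNReal.tsum_add]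
  refine ENNReal.tsum_le_tsum fun i => ?_
  rw [InnerProductSpace.rankOne_apply, map_smul, inner_smul_right]
  simp only [← ofReal_norm]
  rw [← ENNReal.ofReal_pow (norm_nonneg _), ← ENNReal.ofReal_pow (norm_nonneg _),
    ← ENNReal.ofReal_add (by positivity) (by positivity)]
  refine ENNReal.ofReal_le_ofReal ?_
  rw [norm_mul, norm_inner_symm v]
  nlinarith [sq_nonneg (‖⟪b i, K u⟫_ℂ‖ - ‖⟪b i, v⟫_ℂ‖), sq_nonneg ‖⟪b i, K u⟫_ℂ‖,
    sq_nonneg ‖⟪b i, v⟫_ℂ‖]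

end TraceNorm

section TraceClass

variable (𝓗 : Type*) [NormedAddCommGroup 𝓗] [InnerProductSpace ℂ 𝓗] [CompleteSpace 𝓗]

/-- A fixed Hilbert basis of `𝓗` (nothing below depends on the choice). -/
noncomputable def stdBasis : HilbertBasis (exists_hilbertBasis ℂ 𝓗).choose ℂ 𝓗 :=
  (exists_hilbertBasis ℂ 𝓗).choose_spec.choose

/-- The bounded operators `T` with `Tr |T| < ∞`, as a subspace. -/
noncomputable def traceClassSubmodule : Submodule ℂ (𝓗 →L[ℂ] 𝓗) where
  carrier := {T | traceAbs (stdBasis 𝓗) T < ⊤}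
  add_mem' {S T} hS hT := (traceAbs_add_le (stdBasis 𝓗) S T).trans_lt (ENNReal.add_lt_top.2 ⟨hS, hT⟩)
  zero_mem' := by simp [traceAbs_zero]
  smul_mem' c T hT := by
    change traceAbs (stdBasis 𝓗) (c • T) < ⊤
    rw [traceAbs_smul]
    exact ENNReal.mul_lt_top enorm_lt_top hT

/-- The space `𝓑₁(𝓗)` of trace class operators. It carries the trace norm `‖T‖₁ = Tr |T|`, not the
operator norm. -/
def TraceClass : Type _ := traceClassSubmodule 𝓗

noncomputable instance : AddCommGroup (TraceClass 𝓗) :=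
  inferInstanceAs (AddCommGroup (traceClassSubmodule 𝓗))

noncomputable instance : Module ℂ (TraceClass 𝓗) :=
  inferInstanceAs (Module ℂ (traceClassSubmodule 𝓗))

variable {𝓗}

/-- The inclusion of `𝓑₁(𝓗)` in the bounded operators. -/
noncomputable def TraceClass.toCLM : TraceClass 𝓗 →ₗ[ℂ] (𝓗 →L[ℂ] 𝓗) :=
  (traceClassSubmodule 𝓗).subtype

noncomputable instance : Coe (TraceClass 𝓗) (𝓗 →L[ℂ] 𝓗) := ⟨fun T => TraceClass.toCLM T⟩

theorem TraceClass.toCLM_injective :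
    Function.Injective (TraceClass.toCLM : TraceClass 𝓗 →ₗ[ℂ] (𝓗 →L[ℂ] 𝓗)) :=
  Subtype.val_injective

theorem TraceClass.traceAbs_lt_top (T : TraceClass 𝓗) :
    traceAbs (stdBasis 𝓗) (T : 𝓗 →L[ℂ] 𝓗) < ⊤ :=
  T.2

noncomputable instance : Norm (TraceClass 𝓗) :=
  ⟨fun T => (traceAbs (stdBasis 𝓗) (T : 𝓗 →L[ℂ] 𝓗)).toReal⟩

theorem TraceClass.norm_def (T : TraceClass 𝓗) :
    ‖T‖ = (traceAbs (stdBasis 𝓗) (T : 𝓗 →L[ℂ] 𝓗)).toReal := rfl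

theorem TraceClass.normCore : NormedSpace.Core ℂ (TraceClass 𝓗) where
  norm_nonneg T := ENNReal.toReal_nonneg
  norm_smul c T := by
    rw [TraceClass.norm_def, map_smul, traceAbs_smul, ENNReal.toReal_mul, toReal_enorm]
    rfl
  norm_triangle S T := by
    rw [TraceClass.norm_def, map_add]
    exact (ENNReal.toReal_mono (ENNReal.add_lt_top.2 ⟨S.traceAbs_lt_top, T.traceAbs_lt_top⟩).ne
      (traceAbs_add_le _ _ _)).trans
      (ENNReal.toReal_add S.traceAbs_lt_top.ne T.traceAbs_lt_top.ne).le
  norm_eq_zero_iff T := by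
    constructor
    · intro h
      rw [TraceClass.norm_def, ENNReal.toReal_eq_zero_iff] at h
      have h0 := eq_zero_of_traceAbs _ (h.resolve_right T.traceAbs_lt_top.ne)
      exact TraceClass.toCLM_injective (h0.trans (map_zero _).symm)
    · rintro rfl
      rw [TraceClass.norm_def, map_zero, traceAbs_zero, ENNReal.toReal_zero]

noncomputable instance : NormedAddCommGroup (TraceClass 𝓗) :=
  NormedAddCommGroup.ofCore TraceClass.normCore

noncomputable instance : NormedSpace ℂ (TraceClass 𝓗) :=
  NormedSpace.ofCore TraceClass.normCore

/-- The trace `Tr T = ∑ᵢ ⟨bᵢ, T bᵢ⟩` of a trace class operator. -/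
noncomputable def TraceClass.trace (T : TraceClass 𝓗) : ℂ :=
  ∑' i, ⟪stdBasis 𝓗 i, (T : 𝓗 →L[ℂ] 𝓗) (stdBasis 𝓗 i)⟫_ℂ

/-- The rank one operator `u v* : f ↦ ⟨v, f⟩ u` as a trace class operator. -/
noncomputable def TraceClass.rankOne (u v : 𝓗) : TraceClass 𝓗 :=
  ⟨InnerProductSpace.rankOne ℂ u v, traceAbs_rankOne_lt_top _ u v⟩

end TraceClass

/-! ### Families of states -/

section States

variable {𝓗 : Type*} [NormedAddCommGroup 𝓗] [InnerProductSpace ℂ 𝓗] [CompleteSpace 𝓗]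

/-- A density operator: a positive trace class operator of trace one. -/
structure IsState (T : TraceClass 𝓗) : Prop where
  nonneg : (T : 𝓗 →L[ℂ] 𝓗).IsPositive
  trace_eq_one : T.trace = 1

/-- A family of faithful states on `I`, real analytic as a map from `I` to `𝓑₁(𝓗)` (in the trace
norm). -/
structure IsAnalyticStateFamily (I : Set ℝ) (ρ : ℝ → TraceClass 𝓗) : Prop where
  isState : ∀ θ ∈ I, IsState (ρ θ)
  ker_eq_bot : ∀ θ ∈ I, ∀ f : 𝓗, (ρ θ : 𝓗 →L[ℂ] 𝓗) f = 0 → f = 0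
  analytic : AnalyticOn ℝ ρ I

/-- `ρ θ = ∑ₖ lam k θ • e k θ (e k θ)*` on `I`: the `e k θ` form an orthonormal basis of
eigenvectors of `ρ θ`, with eigenvalues `lam k θ` (each eigenvalue is listed as often as its
multiplicity), and both are differentiable in `θ`. -/
structure IsSpectralDecomposition {ι : Type*} (I : Set ℝ) (ρ : ℝ → TraceClass 𝓗)
    (lam : ι → ℝ → ℝ) (e : ι → ℝ → 𝓗) : Prop where
  orthonormal : ∀ θ ∈ I, Orthonormal ℂ (fun k => e k θ)
  total : ∀ θ ∈ I, (Submodule.span ℂ (Set.range fun k => e k θ)).topologicalClosure = ⊤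
  eigen : ∀ θ ∈ I, ∀ k, (ρ θ : 𝓗 →L[ℂ] 𝓗) (e k θ) = (lam k θ : ℂ) • e k θ
  differentiable_lam : ∀ k, DifferentiableOn ℝ (lam k) I
  differentiable_e : ∀ k, DifferentiableOn ℝ (e k) I

/-- The eigenprojections `Pₖ(θ) = eₖ(θ) eₖ(θ)*`. -/
noncomputable def eigenProj {ι : Type*} (e : ι → ℝ → 𝓗) (k : ι) (θ : ℝ) : TraceClass 𝓗 :=
  TraceClass.rankOne (e k θ) (e k θ)

end States

end QuantumLD

open QuantumLD

namespace QuantumLD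

/-! ### The trace class as a Banach space, and its rank one operators. -/

section TraceClassSpace

open Filter Topology

variable {𝓗 : Type*} [NormedAddCommGroup 𝓗] [InnerProductSpace ℂ 𝓗] [CompleteSpace 𝓗]

/-! Everything is compared entry by entry in the eigenbasis `b k = e k θ`. Differentiating
orthonormality gives `⟨eⱼ, eₖ'⟩ = -⟨eⱼ', eₖ⟩`. Differentiating `ρ eₖ = λₖ eₖ` then gives the entries
of `ρ'`, namely `λₖ' δⱼₖ + (λₖ - λⱼ)⟨eⱼ, eₖ'⟩` (`inner_deriv_apply_of_eigen`). The entries of `H`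
have the same shape, with `λₖ'/λₖ` for `λₖ'` and logarithms for eigenvalues. The map `H ↦ ∫ ρᵗ H
ρ¹⁻ᵗ dt` multiplies the entry `(j, k)` by `∫ λⱼᵗ λₖ¹⁻ᵗ dt`, the logarithmic mean of `λⱼ` and `λₖ`,
which turns a difference of logarithms into a difference of eigenvalues
(`integral_rpow_mul_rpow_mul_log`). A bounded operator is determined by its entries, so this proves
the Kubo–Mori–Bogoliubov equation, and in the same way the series for `ρ'`.

What remains is convergence. The eigenvalues sum to one and `|λₖ'| ≤ M λₖ`. For `λₖ ≤ 1/e`, which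
fails for finitely many `k` only, `λₖ ‖eₖ'‖ ≤ λₖ + (|ln λₖ| ‖eₖ'‖)²` (`mul_le_add_log_mul_sq`). As
`‖Pₖ'‖₁ ≤ 2‖eₖ'‖`, both series for `ρ'` converge absolutely in the trace norm, which is complete.
The first part of `H` is a bounded diagonal; the second splits into two sums `∑ bₖ vₖ*` and `∑ vₖ
bₖ*` with `vₖ = ln λₖ • eₖ'` square-summable, whence the factor 2. On a compact set, Dini's theorem
for `∑ λₖ = 1` makes the exceptional finite set independent of the parameter. -/

theorem norm_rankOne_le {𝓗 : Type*} [NormedAddCommGroup 𝓗] [InnerProductSpace ℂ 𝓗]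
    (u v : 𝓗) : ‖InnerProductSpace.rankOne ℂ u v‖ ≤ ‖u‖ * ‖v‖ := by
  refine ContinuousLinearMap.opNorm_le_bound _ (by positivity) fun x => ?_
  rw [InnerProductSpace.rankOne_apply, norm_smul]
  calc ‖⟪v, x⟫_ℂ‖ * ‖u‖ ≤ (‖v‖ * ‖x‖) * ‖u‖ := by gcongr; exact norm_inner_le_norm _ _
    _ = _ := by ring

/-- Testing `T` against the contraction `K = v u*` produces the terms `⟨u, T bᵢ⟩⟨bᵢ, v⟩`, whose sum
is `⟨u, T v⟩` by Parseval. This is how the trace norm dominates the operator norm. -/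
theorem enorm_inner_apply_le_traceAbs {ι : Type*} (b : HilbertBasis ι ℂ 𝓗) (T : 𝓗 →L[ℂ] 𝓗)
    {u v : 𝓗} (hu : ‖u‖ ≤ 1) (hv : ‖v‖ ≤ 1) : ‖⟪u, T v⟫_ℂ‖ₑ ≤ traceAbs b T := by
  have hK : ‖InnerProductSpace.rankOne ℂ v u‖ ≤ 1 :=
    (norm_rankOne_le v u).trans (mul_le_one₀ hv (norm_nonneg _) hu)
  refine le_trans ?_ (tsum_enorm_inner_le_traceAbs b _ T hK)
  have h := b.hasSum_inner_mul_inner ((star T) u) v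
  rw [ContinuousLinearMap.star_eq_adjoint, ContinuousLinearMap.adjoint_inner_left] at h
  have h2 : ∀ i, ⟪b i, InnerProductSpace.rankOne ℂ v u (T (b i))⟫_ℂ
      = ⟪(ContinuousLinearMap.adjoint T) u, b i⟫_ℂ * ⟪b i, v⟫_ℂ := by
    intro i
    rw [InnerProductSpace.rankOne_apply, inner_smul_right, ContinuousLinearMap.adjoint_inner_left]
  simp only [h2]
  rw [← h.tsum_eq]
  exact enorm_tsum_le_tsum_enorm

theorem TraceClass.norm_toCLM_le (T : TraceClass 𝓗) : ‖TraceClass.toCLM T‖ ≤ ‖T‖ := by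
  refine ContinuousLinearMap.opNorm_le_of_unit_norm (norm_nonneg T) fun x hx => ?_
  rcases eq_or_ne (TraceClass.toCLM T x) 0 with h0 | h0
  · rw [h0, norm_zero]; exact norm_nonneg T
  set y := TraceClass.toCLM T x with hy
  have hn : ‖y‖ ≠ 0 := norm_ne_zero_iff.2 h0
  have hu : ‖((‖y‖⁻¹ : ℝ) : ℂ) • y‖ = 1 := by
    rw [norm_smul, Complex.norm_real, norm_inv, norm_norm, inv_mul_cancel₀ hn]
  have h1 := enorm_inner_apply_le_traceAbs (stdBasis 𝓗) (TraceClass.toCLM T) hu.le hx.le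
  have h2 := ENNReal.toReal_mono T.traceAbs_lt_top.ne h1
  rw [toReal_enorm, inner_smul_left, ← hy, inner_self_eq_norm_sq_to_K, Complex.conj_ofReal] at h2
  rw [TraceClass.norm_def]
  refine le_trans (le_of_eq ?_) h2
  simp only [norm_mul, norm_pow, Complex.norm_real, Complex.coe_algebraMap, norm_inv, norm_norm]
  field_simp

/-- The inclusion of `𝓑₁(𝓗)` in the bounded operators, as a continuous linear map. -/
noncomputable def TraceClass.toCLML : TraceClass 𝓗 →L[ℂ] (𝓗 →L[ℂ] 𝓗) :=
  TraceClass.toCLM.mkContinuous 1 fun T => by rw [one_mul]; exact T.norm_toCLM_le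

@[simp] theorem TraceClass.toCLML_apply (T : TraceClass 𝓗) :
    TraceClass.toCLML T = TraceClass.toCLM T := rfl

/-- Lower semicontinuity of `Tr |T|` in the operator norm. -/
theorem traceAbs_le_of_tendsto {ι α : Type*} (b : HilbertBasis ι ℂ 𝓗) {l : Filter α} [l.NeBot]
    {S : α → 𝓗 →L[ℂ] 𝓗} {T : 𝓗 →L[ℂ] 𝓗} {c : ℝ≥0∞} (hS : Tendsto S l (𝓝 T))
    (hc : ∀ᶠ a in l, traceAbs b (S a) ≤ c) : traceAbs b T ≤ c := by
  refine traceAbs_le_of_forall b T fun K hK => ?_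
  rw [ENNReal.tsum_eq_iSup_sum]
  refine iSup_le fun F => ?_
  -- For fixed `K` and finite `F` the sum is continuous in the operator; the supremum over both is
  -- therefore lower semicontinuous.
  have h1 : Tendsto (fun a => ∑ i ∈ F, ‖⟪b i, K (S a (b i))⟫_ℂ‖ₑ) l
      (𝓝 (∑ i ∈ F, ‖⟪b i, K (T (b i))⟫_ℂ‖ₑ)) := by
    refine tendsto_finsetSum _ fun i _ => ?_
    have h2 : Tendsto (fun a => S a (b i)) l (𝓝 (T (b i))) :=
      ((ContinuousLinearMap.apply ℂ 𝓗 (b i)).continuous.tendsto T).comp hS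
    have h3 : Tendsto (fun a => K (S a (b i))) l (𝓝 (K (T (b i)))) :=
      (K.continuous.tendsto _).comp h2
    exact (tendsto_const_nhds.inner h3).enorm
  refine le_of_tendsto h1 (hc.mono fun a ha => ?_)
  exact (ENNReal.sum_le_tsum F).trans ((tsum_enorm_inner_le_traceAbs b K _ hK).trans ha)

/-- A Cauchy sequence converges in operator norm; lower semicontinuity of `Tr |·|`, applied to `u m
- u n` as `m → ∞`, carries the Cauchy estimate over to the limit. -/
theorem TraceClass.exists_tendsto_of_cauchySeq {u : ℕ → TraceClass 𝓗} (hu : CauchySeq u) :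
    ∃ T : TraceClass 𝓗, Tendsto u atTop (𝓝 T) := by
  have h1 : CauchySeq fun n => TraceClass.toCLM (u n) := by
    refine Metric.cauchySeq_iff'.2 fun ε hε => ?_
    obtain ⟨N, hN⟩ := Metric.cauchySeq_iff'.1 hu ε hε
    refine ⟨N, fun n hn => lt_of_le_of_lt ?_ (hN n hn)⟩
    rw [dist_eq_norm, dist_eq_norm, ← map_sub]
    exact TraceClass.norm_toCLM_le _
  obtain ⟨A, hA⟩ := cauchySeq_tendsto_of_complete h1
  have key : ∀ ε : ℝ, 0 < ε → ∃ N, ∀ n ≥ N,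
      traceAbs (stdBasis 𝓗) (A - TraceClass.toCLM (u n)) ≤ ENNReal.ofReal ε := by
    intro ε hε
    obtain ⟨N, hN⟩ := Metric.cauchySeq_iff.1 hu ε hε
    refine ⟨N, fun n hn => ?_⟩
    refine traceAbs_le_of_tendsto (l := atTop) (S := fun m => TraceClass.toCLM (u m) -
      TraceClass.toCLM (u n)) _ (hA.sub_const _) ?_
    filter_upwards [eventually_ge_atTop N] with m hm
    have h2 := hN m hm n hn
    rw [dist_eq_norm, TraceClass.norm_def] at h2
    rw [← map_sub]
    exact (ENNReal.le_ofReal_iff_toReal_le (u m - u n).traceAbs_lt_top.ne hε.le).2 h2.le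
  have hAm : traceAbs (stdBasis 𝓗) A < ⊤ := by
    obtain ⟨N, hN⟩ := key 1 one_pos
    have h2 := traceAbs_add_le (stdBasis 𝓗) (A - TraceClass.toCLM (u N)) (TraceClass.toCLM (u N))
    rw [sub_add_cancel] at h2
    exact h2.trans_lt (ENNReal.add_lt_top.2
      ⟨(hN N le_rfl).trans_lt ENNReal.ofReal_lt_top, (u N).traceAbs_lt_top⟩)
  obtain ⟨T, hT⟩ : ∃ T : TraceClass 𝓗, TraceClass.toCLM T = A := ⟨⟨A, hAm⟩, rfl⟩
  refine ⟨T, Metric.tendsto_atTop.2 fun ε hε => ?_⟩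
  obtain ⟨N, hN⟩ := key (ε / 2) (half_pos hε)
  refine ⟨N, fun n hn => ?_⟩
  rw [dist_comm, dist_eq_norm, TraceClass.norm_def, map_sub, hT]
  refine lt_of_le_of_lt ?_ (half_lt_self hε)
  exact ENNReal.toReal_le_of_le_ofReal (half_pos hε).le (hN n hn)

instance : CompleteSpace (TraceClass 𝓗) :=
  Metric.complete_of_cauchySeq_tendsto fun _ hu => TraceClass.exists_tendsto_of_cauchySeq hu

/-- Cauchy–Schwarz followed by Bessel gives the product bound, which the bilinear map
`TraceClass.rankOneL` needs for continuity. -/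
theorem traceAbs_rankOne_le {ι : Type*} (b : HilbertBasis ι ℂ 𝓗) (u v : 𝓗) :
    traceAbs b (InnerProductSpace.rankOne ℂ u v) ≤ ENNReal.ofReal (‖u‖ * ‖v‖) := by
  refine traceAbs_le_of_forall b _ fun K hK => ?_
  rw [ENNReal.tsum_eq_iSup_sum]
  refine iSup_le fun F => ?_
  simp only [← ofReal_norm]
  rw [← ENNReal.ofReal_sum_of_nonneg fun _ _ => norm_nonneg _]
  refine ENNReal.ofReal_le_ofReal ?_
  have h1 : ∀ x, √(∑ i ∈ F, ‖⟪b i, x⟫_ℂ‖ ^ 2) ≤ ‖x‖ := fun x =>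
    Real.sqrt_le_iff.2 ⟨norm_nonneg x, b.orthonormal.sum_inner_products_le x⟩
  calc ∑ i ∈ F, ‖⟪b i, K (InnerProductSpace.rankOne ℂ u v (b i))⟫_ℂ‖
      = ∑ i ∈ F, ‖⟪b i, K u⟫_ℂ‖ * ‖⟪b i, v⟫_ℂ‖ := by
        refine Finset.sum_congr rfl fun i _ => ?_
        rw [InnerProductSpace.rankOne_apply, map_smul, inner_smul_right, norm_mul,
          norm_inner_symm v, mul_comm]
    _ ≤ √(∑ i ∈ F, ‖⟪b i, K u⟫_ℂ‖ ^ 2) * √(∑ i ∈ F, ‖⟪b i, v⟫_ℂ‖ ^ 2) :=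
        Real.sum_mul_le_sqrt_mul_sqrt _ _ _
    _ ≤ ‖K u‖ * ‖v‖ := mul_le_mul (h1 _) (h1 _) (Real.sqrt_nonneg _) (norm_nonneg _)
    _ ≤ ‖u‖ * ‖v‖ := by
        gcongr
        exact (K.le_opNorm _).trans (mul_le_of_le_one_left (norm_nonneg _) hK)

theorem TraceClass.toCLM_rankOne (u v : 𝓗) :
    TraceClass.toCLM (TraceClass.rankOne u v) = InnerProductSpace.rankOne ℂ u v := rfl

theorem TraceClass.toCLM_rankOne_apply (u v f : 𝓗) :
    TraceClass.toCLM (TraceClass.rankOne u v) f = ⟪v, f⟫_ℂ • u := by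
  rw [TraceClass.toCLM_rankOne, InnerProductSpace.rankOne_apply]

theorem TraceClass.norm_rankOne_le (u v : 𝓗) : ‖TraceClass.rankOne u v‖ ≤ ‖u‖ * ‖v‖ := by
  rw [TraceClass.norm_def]
  exact ENNReal.toReal_le_of_le_ofReal (by positivity) (traceAbs_rankOne_le _ u v)

/-- `(u, v) ↦ u v*` as a bounded real bilinear map to `𝓑₁(𝓗)`. -/
noncomputable def TraceClass.rankOneL : 𝓗 →L[ℝ] 𝓗 →L[ℝ] TraceClass 𝓗 :=
  LinearMap.mkContinuous₂ (LinearMap.mk₂ ℝ TraceClass.rankOne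
    (fun u u' v => TraceClass.toCLM_injective (by
      rw [map_add]; ext f; simp [TraceClass.toCLM_rankOne_apply]))
    (fun c u v => TraceClass.toCLM_injective (by
      ext f
      rw [show c • TraceClass.rankOne u v = (c : ℂ) • TraceClass.rankOne u v from rfl, map_smul]
      simp [TraceClass.toCLM_rankOne_apply, smul_comm c]))
    (fun u v v' => TraceClass.toCLM_injective (by
      rw [map_add]; ext f; simp [TraceClass.toCLM_rankOne_apply, add_smul]))
    (fun c u v => TraceClass.toCLM_injective (by
      ext f
      rw [show c • TraceClass.rankOne u v = (c : ℂ) • TraceClass.rankOne u v from rfl, map_smul,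
        show c • v = (c : ℂ) • v from rfl]
      simp [TraceClass.toCLM_rankOne_apply, mul_smul]))) 1
    fun u v => by rw [one_mul]; exact TraceClass.norm_rankOne_le u v

/-- The product rule for the bounded bilinear map `(u, v) ↦ u v*`; boundedness into the trace class
makes the derivative one in trace norm. -/
theorem hasDerivWithinAt_eigenProj {ι : Type*} {e : ι → ℝ → 𝓗} {k : ι} {I : Set ℝ} {θ : ℝ}
    {d : 𝓗} (h : HasDerivWithinAt (e k) d I θ) :
    HasDerivWithinAt (eigenProj e k)
      (TraceClass.rankOne (e k θ) d + TraceClass.rankOne d (e k θ)) I θ :=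
  TraceClass.rankOneL.hasDerivWithinAt_of_bilinear h h

end TraceClassSpace

/-! ### Operators given by series in a Hilbert basis. -/

section BasisOperators

open Filter Topology

variable {𝓗 : Type*} [NormedAddCommGroup 𝓗] [InnerProductSpace ℂ 𝓗] {ι : Type*}

theorem hasSum_norm_inner_sq (b : HilbertBasis ι ℂ 𝓗) (x : 𝓗) :
    HasSum (fun k => ‖⟪b k, x⟫_ℂ‖ ^ 2) (‖x‖ ^ 2) := by
  have h := Complex.hasSum_re (b.hasSum_inner_mul_inner x x)
  convert h using 2 with i
  · have h4 := inner_mul_symm_re_eq_norm (𝕜 := ℂ) x (b i)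
    rw [norm_mul, norm_inner_symm x, ← sq] at h4
    exact h4.symm
  · exact (inner_self_eq_norm_sq (𝕜 := ℂ) x).symm

theorem eq_of_forall_inner_basis (b : HilbertBasis ι ℂ 𝓗) {x y : 𝓗}
    (h : ∀ j, ⟪b j, x⟫_ℂ = ⟪b j, y⟫_ℂ) : x = y := by
  have h1 := hasSum_norm_inner_sq b (x - y)
  simp only [inner_sub_right, h, sub_self, norm_zero, ne_eq, OfNat.ofNat_ne_zero,
    not_false_eq_true, zero_pow] at h1
  have h2 := h1.unique hasSum_zero
  exact sub_eq_zero.1 (norm_eq_zero.1 (pow_eq_zero_iff (two_ne_zero) |>.1 h2))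

/-- An operator is determined by its matrix elements. -/
theorem eq_of_forall_matrix (b : HilbertBasis ι ℂ 𝓗) {A B : 𝓗 →L[ℂ] 𝓗}
    (h : ∀ j k, ⟪b j, A (b k)⟫_ℂ = ⟪b j, B (b k)⟫_ℂ) : A = B := by
  refine ContinuousLinearMap.ext_on
    (Submodule.dense_iff_topologicalClosure_eq_top.2 b.dense_span) ?_
  rintro _ ⟨k, rfl⟩
  exact eq_of_forall_inner_basis b fun j => h j k

theorem hasSum_mul_inner_basis_right (b : HilbertBasis ι ℂ 𝓗) (z : ι → ℂ) (k : ι) :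
    HasSum (fun m => z m * ⟪b m, b k⟫_ℂ) (z k) := by
  have h := hasSum_single (f := fun m => z m * ⟪b m, b k⟫_ℂ) k fun m hm => by
    rw [b.orthonormal.2 hm, mul_zero]
  rwa [inner_self_eq_one_of_norm_eq_one (b.orthonormal.1 k), mul_one] at h

theorem hasSum_mul_inner_basis_left (b : HilbertBasis ι ℂ 𝓗) (z : ι → ℂ) (j : ι) :
    HasSum (fun m => z m * ⟪b j, b m⟫_ℂ) (z j) := by
  have h := hasSum_single (f := fun m => z m * ⟪b j, b m⟫_ℂ) j fun m hm => by
    rw [b.orthonormal.2 hm.symm, mul_zero]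
  rwa [inner_self_eq_one_of_norm_eq_one (b.orthonormal.1 j), mul_one] at h

/-- The operator `f ↦ ∑ₖ aₖ(f) bₖ` for functionals `aₖ` with `∑ₖ |aₖ(f)|² ≤ M² ‖f‖²`. -/
theorem exists_hasSum_functional_smul_basis (b : HilbertBasis ι ℂ 𝓗) (a : ι → 𝓗 →L[ℂ] ℂ) {M : ℝ}
    (hM : 0 ≤ M) (ha : ∀ f, Summable fun k => ‖a k f‖ ^ 2)
    (ha' : ∀ f, ∑' k, ‖a k f‖ ^ 2 ≤ (M * ‖f‖) ^ 2) :
    ∃ D : 𝓗 →L[ℂ] 𝓗, (∀ f, HasSum (fun k => a k f • b k) (D f)) ∧ ‖D‖ ≤ M := by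
  have hmem : ∀ f, Memℓp (fun k => a k f) 2 := fun f =>
    memℓp_gen (by simpa using ha f)
  let c : 𝓗 → lp (fun _ : ι => ℂ) 2 := fun f => ⟨fun k => a k f, hmem f⟩
  have hs : ∀ f, HasSum (fun k => a k f • b k) (b.repr.symm (c f)) := fun f =>
    b.hasSum_repr_symm (c f)
  have hn : ∀ f, ‖b.repr.symm (c f)‖ ≤ M * ‖f‖ := by
    intro f
    rw [LinearIsometryEquiv.norm_map]
    refine lp.norm_le_of_tsum_le (by norm_num) (by positivity) ?_
    simpa using ha' f
  let D : 𝓗 →ₗ[ℂ] 𝓗 :=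
    { toFun := fun f => b.repr.symm (c f)
      map_add' := fun f g => by
        refine (hs (f + g)).unique ?_
        simpa only [map_add, add_smul] using (hs f).add (hs g)
      map_smul' := fun z f => by
        refine (hs (z • f)).unique ?_
        simpa only [map_smul, smul_eq_mul, mul_smul, RingHom.id_apply] using (hs f).const_smul z }
  exact ⟨D.mkContinuous M hn, hs, D.mkContinuous_norm_le hM hn⟩

/-- A bounded real sequence is the diagonal of a bounded operator. -/
theorem exists_hasSum_diagonal (b : HilbertBasis ι ℂ 𝓗) (c : ι → ℝ) {M : ℝ} (hM : 0 ≤ M)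
    (hc : ∀ k, |c k| ≤ M) :
    ∃ D : 𝓗 →L[ℂ] 𝓗, (∀ f, HasSum (fun k => ((c k : ℂ) * ⟪b k, f⟫_ℂ) • b k) (D f)) ∧ ‖D‖ ≤ M := by
  have h1 : ∀ f k, ‖((c k : ℂ) • innerSL ℂ (b k)) f‖ ^ 2 ≤ M ^ 2 * ‖⟪b k, f⟫_ℂ‖ ^ 2 := by
    intro f k
    rw [smul_apply, norm_smul, Complex.norm_real, mul_pow, innerSL_apply_apply]
    gcongr
    exact hc k
  have h2 := fun f => (hasSum_norm_inner_sq b f).mul_left (M ^ 2)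
  have h3 := fun f => Summable.of_nonneg_of_le (fun k => by positivity) (h1 f) (h2 f).summable
  refine exists_hasSum_functional_smul_basis b (fun k => (c k : ℂ) • innerSL ℂ (b k)) hM h3
    fun f => ?_
  rw [mul_pow, ← (h2 f).tsum_eq]
  exact (h3 f).tsum_le_tsum (h1 f) (h2 f).summable

/-- The operator `∑ₖ bₖ vₖ*`, for a square summable family `v`. -/
theorem exists_hasSum_inner_smul_basis (b : HilbertBasis ι ℂ 𝓗) {v : ι → 𝓗}
    (hv : Summable fun k => ‖v k‖ ^ 2) :
    ∃ D : 𝓗 →L[ℂ] 𝓗, (∀ f, HasSum (fun k => ⟪v k, f⟫_ℂ • b k) (D f)) ∧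
      ‖D‖ ≤ √(∑' k, ‖v k‖ ^ 2) := by
  have h1 : ∀ f k, ‖innerSL ℂ (v k) f‖ ^ 2 ≤ ‖v k‖ ^ 2 * ‖f‖ ^ 2 := by
    intro f k
    rw [innerSL_apply_apply, ← mul_pow]
    gcongr
    exact norm_inner_le_norm _ _
  have h2 := fun f : 𝓗 => hv.mul_right (‖f‖ ^ 2)
  have h3 := fun f => Summable.of_nonneg_of_le (fun k => by positivity) (h1 f) (h2 f)
  refine exists_hasSum_functional_smul_basis b (fun k => innerSL ℂ (v k)) (Real.sqrt_nonneg _) h3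
    fun f => ?_
  rw [mul_pow, Real.sq_sqrt (tsum_nonneg fun k => by positivity), ← tsum_mul_right]
  exact (h3 f).tsum_le_tsum (h1 f) (h2 f)

/-- The operator `∑ₖ vₖ bₖ*`, for a square summable family `v`. -/
theorem exists_hasSum_inner_basis_smul [CompleteSpace 𝓗] (b : HilbertBasis ι ℂ 𝓗) {v : ι → 𝓗}
    (hv : Summable fun k => ‖v k‖ ^ 2) :
    ∃ D : 𝓗 →L[ℂ] 𝓗, (∀ f, HasSum (fun k => ⟪b k, f⟫_ℂ • v k) (D f)) ∧
      ‖D‖ ≤ √(∑' k, ‖v k‖ ^ 2) := by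
  set M := √(∑' k, ‖v k‖ ^ 2) with hM
  -- The `v k` need not be orthogonal, so convergence in `ℓ²` does not help; Cauchy–Schwarz gives
  -- absolute convergence instead.
  have hF : ∀ (f : 𝓗) (F : Finset ι), ∑ k ∈ F, ‖⟪b k, f⟫_ℂ • v k‖ ≤ M * ‖f‖ := by
    intro f F
    simp only [norm_smul]
    refine (Real.sum_mul_le_sqrt_mul_sqrt _ _ _).trans ?_
    rw [mul_comm M]
    refine mul_le_mul ?_ (Real.sqrt_le_sqrt (hv.sum_le_tsum _ fun _ _ => by positivity))
      (Real.sqrt_nonneg _) (norm_nonneg _)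
    exact Real.sqrt_le_iff.2 ⟨norm_nonneg f, b.orthonormal.sum_inner_products_le f⟩
  have hs : ∀ f, HasSum (fun k => ⟪b k, f⟫_ℂ • v k) (∑' k, ⟪b k, f⟫_ℂ • v k) := fun f =>
    (Summable.of_norm (summable_of_sum_le (fun _ => norm_nonneg _) (hF f))).hasSum
  have hn : ∀ f, ‖∑' k, ⟪b k, f⟫_ℂ • v k‖ ≤ M * ‖f‖ := fun f =>
    le_of_tendsto (hs f).norm (Eventually.of_forall fun F => (norm_sum_le _ _).trans (hF f F))
  let D : 𝓗 →ₗ[ℂ] 𝓗 :=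
    { toFun := fun f => ∑' k, ⟪b k, f⟫_ℂ • v k
      map_add' := fun f g => by
        refine (hs (f + g)).unique ?_
        simpa only [inner_add_right, add_smul] using (hs f).add (hs g)
      map_smul' := fun z f => by
        refine (hs (z • f)).unique ?_
        simpa only [inner_smul_right, mul_smul, RingHom.id_apply] using (hs f).const_smul z }
  exact ⟨D.mkContinuous M hn, hs, D.mkContinuous_norm_le (Real.sqrt_nonneg _) hn⟩

end BasisOperators

/-! ### Real powers of a positive operator and the integral `∫₀¹ aᵗ H a¹⁻ᵗ dt`. -/

section FunctionalCalculus

open Filter Topology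

variable {𝓗 : Type*} [NormedAddCommGroup 𝓗] [InnerProductSpace ℂ 𝓗] [CompleteSpace 𝓗]

theorem aeval_apply_of_apply_eq_smul {𝓗 : Type*} [NormedAddCommGroup 𝓗]
    [InnerProductSpace ℂ 𝓗] {a : 𝓗 →L[ℂ] 𝓗} {v : 𝓗} {μ : ℝ} (h : a v = (μ : ℂ) • v)
    (p : Polynomial ℝ) : Polynomial.aeval a p v = ((p.eval μ : ℝ) : ℂ) • v := by
  have hpow : ∀ n : ℕ, (a ^ n) v = ((μ : ℂ) ^ n) • v := by
    intro n
    induction n with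
    | zero => simp
    | succ n ih => rw [pow_succ, mul_apply_eq_comp, h, map_smul, ih, smul_smul, pow_succ']
  induction p using Polynomial.induction_on' with
  | add p q hp hq => simp [hp, hq, add_smul]
  | monomial n c =>
    rw [Polynomial.aeval_monomial, Polynomial.eval_monomial, mul_apply_eq_comp, hpow,
      Algebra.algebraMap_eq_smul_one, smul_apply, one_apply_eq_self, show ∀ x : 𝓗, c • x = (c : ℂ) • x from fun _ => rfl,
      smul_smul]
    push_cast
    rfl

/-- The continuous functional calculus acts on eigenvectors through the eigenvalue. -/
theorem cfc_apply_of_apply_eq_smul {a : 𝓗 →L[ℂ] 𝓗} (ha : IsSelfAdjoint a) {f : ℝ → ℝ}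
    (hf : Continuous f) {v : 𝓗} {μ : ℝ} (h : a v = (μ : ℂ) • v) :
    cfc f a v = ((f μ : ℝ) : ℂ) • v := by
  rcases subsingleton_or_nontrivial 𝓗 with _ | _
  · exact Subsingleton.elim _ _
  -- One polynomial must approximate `f` on the spectrum and at `μ`. As `v = 0` is allowed, `μ` need
  -- not lie in the spectrum, hence the maximum.
  set M := max ‖a‖ |μ|
  refine eq_of_forall_dist_le fun ε hε => ?_
  set δ := ε / (2 * (‖v‖ + 1)) with hδ
  have hδ0 : 0 < δ := by positivity
  obtain ⟨p, hp⟩ := exists_polynomial_near_of_continuousOn (-M) M f hf.continuousOn δ hδ0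
  have h1 : ‖cfc f a - Polynomial.aeval a p‖ ≤ δ := by
    rw [← cfc_polynomial p a ha, ← cfc_sub f p.eval a hf.continuousOn p.continuous.continuousOn]
    refine norm_cfc_le hδ0.le fun x hx => ?_
    have hx1 := spectrum.norm_le_norm_of_mem hx
    rw [Real.norm_eq_abs, abs_sub_comm]
    exact (hp x (abs_le.1 (hx1.trans (le_max_left _ _)))).le
  have h2 : |p.eval μ - f μ| ≤ δ := (hp μ (abs_le.1 (le_max_right _ _))).le
  have h3 : cfc f a v - ((f μ : ℝ) : ℂ) • v = (cfc f a - Polynomial.aeval a p) v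
      + ((p.eval μ - f μ : ℝ) : ℂ) • v := by
    rw [sub_apply, aeval_apply_of_apply_eq_smul h]
    push_cast
    rw [sub_smul]
    abel
  rw [dist_eq_norm, h3]
  have h4 : ‖(cfc f a - Polynomial.aeval a p) v‖ ≤ δ * ‖v‖ :=
    (ContinuousLinearMap.le_opNorm _ _).trans (by gcongr)
  have h5 : ‖((p.eval μ - f μ : ℝ) : ℂ) • v‖ ≤ δ * ‖v‖ := by
    rw [norm_smul, Complex.norm_real]
    gcongr
    exact h2
  calc _ ≤ δ * ‖v‖ + δ * ‖v‖ := (norm_add_le _ _).trans (add_le_add h4 h5)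
    _ ≤ 2 * (‖v‖ + 1) * δ := by nlinarith
    _ = ε := by rw [hδ]; field_simp

theorem rpow_apply_of_apply_eq_smul {a : 𝓗 →L[ℂ] 𝓗} (ha : 0 ≤ a) {t : ℝ} (ht : 0 ≤ t) {v : 𝓗}
    {μ : ℝ} (h : a v = (μ : ℂ) • v) : (a ^ t) v = ((μ ^ t : ℝ) : ℂ) • v := by
  rw [CFC.rpow_eq_cfc_real ha]
  exact cfc_apply_of_apply_eq_smul ha.isSelfAdjoint (Real.continuous_rpow_const ht) h

/-- Joint continuity of `x ^ s` on the compact spectrum gives uniform convergence in `x`. Exponent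
`0` is left out: since `0 ^ 0 = 1`, joint continuity fails at the origin, and `0` may lie in the
spectrum. -/
theorem continuousOn_rpow_exponent {a : 𝓗 →L[ℂ] 𝓗} (ha : 0 ≤ a) :
    ContinuousOn (fun t : ℝ => a ^ t) (Set.Ioi 0) := by
  have h0 : (fun t : ℝ => a ^ t) = fun t => cfc (fun x : ℝ => x ^ t) a :=
    funext fun t => CFC.rpow_eq_cfc_real ha
  rw [h0]
  intro t ht
  refine continuousWithinAt_cfc_fun ?_ ?_
  · intro u hu
    have hf : ContinuousOn (Function.uncurry fun (s x : ℝ) => x ^ s)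
        (Set.Ioi 0 ×ˢ spectrum ℝ a) := by
      rintro ⟨s, x⟩ ⟨hs, -⟩
      refine ContinuousAt.continuousWithinAt ?_
      exact (Real.continuousAt_rpow_of_pos (x, s) hs).comp (f := Prod.swap) (x := (s, x))
        continuous_swap.continuousAt
    obtain ⟨w, hw, hwu⟩ := (spectrum.isCompact (𝕜 := ℝ) a).mem_uniformity_of_prod hf ht
      (symm_le_uniformity hu)
    filter_upwards [hw] with s hs x hx
    exact hwu s hs x hx
  · filter_upwards [self_mem_nhdsWithin] with s hs
    exact (Real.continuous_rpow_const (le_of_lt hs)).continuousOn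

theorem intervalIntegrable_rpow_mul_mul_rpow {a : 𝓗 →L[ℂ] 𝓗} (ha : 0 ≤ a) (H : 𝓗 →L[ℂ] 𝓗) :
    IntervalIntegrable (fun t : ℝ => a ^ t * H * a ^ (1 - t)) MeasureTheory.volume 0 1 := by
  rw [intervalIntegrable_iff_integrableOn_Ioo_of_le zero_le_one]
  have hc : ContinuousOn (fun t : ℝ => a ^ t * H * a ^ (1 - t)) (Set.Ioo 0 1) := by
    refine (((continuousOn_rpow_exponent ha).mono fun t ht => ht.1).mul continuousOn_const).mul ?_
    refine (continuousOn_rpow_exponent ha).comp (by fun_prop) fun t ht => ?_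
    exact sub_pos.2 ht.2
  -- The base `1 + ‖a‖` is at least one, so its powers increase with `t` and the bound is uniform.
  have hn : ∀ t : ℝ, 0 < t → t ≤ 1 → ‖a ^ t‖ ≤ 1 + ‖a‖ := by
    intro t h0 h1
    rw [CFC.norm_rpow a h0 ha]
    calc ‖a‖ ^ t ≤ (1 + ‖a‖) ^ t := Real.rpow_le_rpow (norm_nonneg _) (by linarith) h0.le
      _ ≤ (1 + ‖a‖) ^ (1 : ℝ) :=
        Real.rpow_le_rpow_of_exponent_le (by linarith [norm_nonneg a]) h1
      _ = _ := Real.rpow_one _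
  refine MeasureTheory.IntegrableOn.of_bound (by simp) (hc.aestronglyMeasurable measurableSet_Ioo)
    ((1 + ‖a‖) * ‖H‖ * (1 + ‖a‖)) ?_
  refine (MeasureTheory.ae_restrict_iff' measurableSet_Ioo).2 (Eventually.of_forall fun t ht => ?_)
  refine (norm_mul_le _ _).trans ?_
  gcongr
  · refine (norm_mul_le _ _).trans ?_
    gcongr
    exact hn t ht.1 ht.2.le
  · exact hn _ (sub_pos.2 ht.2) (by linarith [ht.1])

/-- The integrand times the difference of logarithms is the derivative of `-(xᵗ y¹⁻ᵗ)`. The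
undivided form also covers `x = y`, needed because different indices may share an eigenvalue. -/
theorem integral_rpow_mul_rpow_mul_log {x y : ℝ} (hx : 0 < x) (hy : 0 < y) :
    (∫ t in (0 : ℝ)..1, x ^ t * y ^ (1 - t)) * (Real.log y - Real.log x) = y - x := by
  rw [← intervalIntegral.integral_mul_const]
  have hd : ∀ t ∈ Set.uIcc (0 : ℝ) 1, HasDerivAt (fun t : ℝ => -(x ^ t * y ^ (1 - t)))
      (x ^ t * y ^ (1 - t) * (Real.log y - Real.log x)) t := by
    intro t _
    have h1 : HasDerivAt (fun t : ℝ => x ^ t) (Real.log x * 1 * x ^ t) t :=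
      (hasDerivAt_id t).const_rpow hx
    have h2 : HasDerivAt (fun t : ℝ => y ^ (1 - t)) (Real.log y * -1 * y ^ (1 - t)) t :=
      ((hasDerivAt_id t).const_sub 1).const_rpow hy
    refine (h1.mul h2).neg.congr_deriv ?_
    ring
  have hc : Continuous fun t : ℝ => x ^ t * y ^ (1 - t) * (Real.log y - Real.log x) := by
    have h1 : Continuous fun t : ℝ => x ^ t := Real.continuous_const_rpow hx.ne'
    have h2 : Continuous fun t : ℝ => y ^ (1 - t) :=
      (Real.continuous_const_rpow hy.ne').comp (by fun_prop)
    fun_prop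
  rw [intervalIntegral.integral_eq_sub_of_hasDerivAt hd (hc.intervalIntegrable _ _)]
  simp
  ring

theorem integral_rpow_mul_rpow_self {x : ℝ} (hx : 0 < x) :
    ∫ t in (0 : ℝ)..1, x ^ t * x ^ (1 - t) = x := by
  simp [← Real.rpow_add hx]

/-- The matrix elements of `∫₀¹ aᵗ H a¹⁻ᵗ dt` in a basis of eigenvectors of `a`. -/
theorem inner_integral_rpow_mul_mul_rpow {a : 𝓗 →L[ℂ] 𝓗} (ha : 0 ≤ a) (H : 𝓗 →L[ℂ] 𝓗)
    {u v : 𝓗} {x y : ℝ} (hu : a u = (x : ℂ) • u) (hv : a v = (y : ℂ) • v) :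
    ⟪u, (∫ t in (0 : ℝ)..1, a ^ t * H * a ^ (1 - t)) v⟫_ℂ
      = ((∫ t in (0 : ℝ)..1, x ^ t * y ^ (1 - t) : ℝ) : ℂ) * ⟪u, H v⟫_ℂ := by
  -- The functional `A ↦ ⟨u, A v⟩` is continuous and linear, so it passes under the Bochner
  -- integral.
  have h1 := ((innerSL ℂ u).comp
    (ContinuousLinearMap.apply ℂ 𝓗 v)).intervalIntegral_comp_comm
    (intervalIntegrable_rpow_mul_mul_rpow ha H)
  refine h1.symm.trans ?_
  rw [← intervalIntegral.integral_ofReal, ← intervalIntegral.integral_mul_const]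
  refine intervalIntegral.integral_congr fun t ht => ?_
  rw [Set.uIcc_of_le zero_le_one] at ht
  have h2 := rpow_apply_of_apply_eq_smul ha ht.1 hu
  have h3 := rpow_apply_of_apply_eq_smul ha (sub_nonneg.2 ht.2) hv
  have h4 : star (a ^ t) = a ^ t := (CFC.rpow_nonneg (a := a) (y := t)).isSelfAdjoint.star_eq
  change ⟪u, (a ^ t) (H ((a ^ (1 - t)) v))⟫_ℂ = _
  rw [h3, ← h4, ContinuousLinearMap.star_eq_adjoint, ContinuousLinearMap.adjoint_inner_right, h2,
    map_smul, inner_smul_left, inner_smul_right, Complex.conj_ofReal, ← mul_assoc]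
  push_cast
  rfl

end FunctionalCalculus

/-! ### Summability of `∑ λₖ ‖eₖ'‖`, pointwise and uniform. -/

section Series

open Filter Topology

variable {ι : Type*}

/-- Here `|log x| ≥ 1`, so `c ≤ y` with `y = |log x| c`. Then `x y ≤ x` if `y ≤ 1`, and `x y ≤ y ≤
y²` otherwise, since `x ≤ 1`. -/
theorem mul_le_add_log_mul_sq {x c : ℝ} (hx : 0 < x) (hx' : x ≤ Real.exp (-1)) (hc : 0 ≤ c) :
    x * c ≤ x + (|Real.log x| * c) ^ 2 := by
  have h1 : Real.log x ≤ -1 := (Real.log_le_iff_le_exp hx).2 hx'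
  have h2 : 1 ≤ |Real.log x| := by rw [abs_of_neg (by linarith)]; linarith
  have h3 : c ≤ |Real.log x| * c := le_mul_of_one_le_left hc h2
  have h4 : x ≤ 1 := hx'.trans (by rw [Real.exp_le_one_iff]; norm_num)
  set y := |Real.log x| * c
  nlinarith [sq_nonneg (y - 1), sq_nonneg y, mul_nonneg hx.le (sub_nonneg.2 h3)]

theorem summable_mul_of_summable_log_mul_sq {x c : ι → ℝ} (hx : ∀ k, 0 < x k) (hc : ∀ k, 0 ≤ c k)
    (hxs : Summable x) (hs : Summable fun k => (|Real.log (x k)| * c k) ^ 2) :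
    Summable fun k => x k * c k := by
  refine Summable.of_norm_bounded_eventually (hxs.add hs) ?_
  filter_upwards [hxs.tendsto_cofinite_zero.eventually_le_const (Real.exp_pos (-1))] with k hk
  rw [Real.norm_of_nonneg (mul_nonneg (hx k).le (hc k))]
  exact mul_le_add_log_mul_sq (hx k) hk (hc k)

variable {α : Type*} {K : Set α}

/-- Once a finite set contains `F₀`, the tail of `f` beyond it lies below that of `g`. Terms in `F₀`
enter the partial sums exactly, so no bound on them is required. -/
theorem SummableUniformlyOn.of_nonneg_of_le_compl {f g : ι → α → ℝ} (F₀ : Finset ι)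
    (hg : SummableUniformlyOn g K) (hf : ∀ k, ∀ x ∈ K, 0 ≤ f k x)
    (hfg : ∀ k ∉ F₀, ∀ x ∈ K, f k x ≤ g k x) : SummableUniformlyOn f K := by
  classical
  have hgs : ∀ x ∈ K, Summable (g · x) := fun x hx => hg.summable hx
  have hfs : ∀ x ∈ K, Summable (f · x) := by
    intro x hx
    refine Summable.of_norm_bounded_eventually (hgs x hx) ?_
    filter_upwards [F₀.finite_toSet.compl_mem_cofinite] with k hk
    rw [Real.norm_of_nonneg (hf k x hx)]
    exact hfg k hk x hx
  have hg' := hg.hasSumUniformlyOn.tendstoUniformlyOn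
  refine HasSumUniformlyOn.summableUniformlyOn (g := fun x => ∑' k, f k x)
    (hasSumUniformlyOn_iff_tendstoUniformlyOn.2 ?_)
  rw [Metric.tendstoUniformlyOn_iff] at hg' ⊢
  intro ε hε
  filter_upwards [hg' ε hε, eventually_ge_atTop F₀] with F hF hF₀ x hx
  have h1 := hF x hx
  have h2 := (hgs x hx).sum_add_tsum_compl (s := F)
  have h3 := (hfs x hx).sum_add_tsum_compl (s := F)
  have hsf := (hfs x hx).subtype ((F : Set ι)ᶜ)
  have hsg := (hgs x hx).subtype ((F : Set ι)ᶜ)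
  have h4 : ∑' k : ((F : Set ι)ᶜ : Set ι), f k x ≤ ∑' k : ((F : Set ι)ᶜ : Set ι), g k x :=
    hsf.tsum_le_tsum (fun k => hfg k (fun hk => k.2 (hF₀ hk)) x hx) hsg
  have h5 : 0 ≤ ∑' k : ((F : Set ι)ᶜ : Set ι), f k x := tsum_nonneg fun k => hf k x hx
  rw [Real.dist_eq, ← h2, add_sub_cancel_left] at h1
  rw [Real.dist_eq, ← h3, add_sub_cancel_left, abs_of_nonneg h5]
  exact lt_of_le_of_lt (h4.trans (le_abs_self _)) h1

/-- Dini's theorem for series of continuous functions with constant sum. -/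
theorem hasSumUniformlyOn_of_hasSum_const [TopologicalSpace α] (hK : IsCompact K)
    {f : ι → α → ℝ} {c : ℝ} (hf : ∀ k, ∀ x ∈ K, 0 ≤ f k x) (hc : ∀ k, ContinuousOn (f k) K)
    (hs : ∀ x ∈ K, HasSum (f · x) c) : HasSumUniformlyOn f (fun _ => c) K := by
  refine hasSumUniformlyOn_iff_tendstoUniformlyOn.2 ?_
  refine Monotone.tendstoUniformlyOn_of_forall_tendsto hK
    (fun F => continuousOn_finsetSum F fun k _ => hc k) ?_ continuousOn_const hs
  intro x hx F G hFG
  exact Finset.sum_le_sum_of_subset_of_nonneg hFG fun k _ _ => hf k x hx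

theorem summableUniformlyOn_mul_of_log_mul_sq [TopologicalSpace α] (hK : IsCompact K)
    {x c : ι → α → ℝ} (hx : ∀ k, ∀ θ ∈ K, 0 < x k θ) (hxc : ∀ k, ContinuousOn (x k) K)
    (hx1 : ∀ θ ∈ K, HasSum (x · θ) 1) (hc : ∀ k, ∀ θ ∈ K, 0 ≤ c k θ)
    (hs : SummableUniformlyOn (fun k θ => (|Real.log (x k θ)| * c k θ) ^ 2) K) :
    SummableUniformlyOn (fun k θ => x k θ * c k θ) K := by
  classical
  have h1 := hasSumUniformlyOn_of_hasSum_const hK (fun k θ hθ => (hx k θ hθ).le) hxc hx1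
  obtain ⟨g, hg⟩ := hs.exists
  have h2 : SummableUniformlyOn (fun k θ => x k θ + (|Real.log (x k θ)| * c k θ) ^ 2) K := by
    refine HasSumUniformlyOn.summableUniformlyOn (g := (fun _ => 1) + g)
      (hasSumUniformlyOn_iff_tendstoUniformlyOn.2 ?_)
    have h3 := h1.tendstoUniformlyOn.add hg.tendstoUniformlyOn
    refine h3.congr (Eventually.of_forall fun F θ _ => ?_)
    simp [Finset.sum_add_distrib]
  -- Uniform convergence provides one `F₀` for all of `K` beyond which the remainder is below `1/e`.
  have h4 := Metric.tendstoUniformlyOn_iff.1 h1.tendstoUniformlyOn _ (Real.exp_pos (-1))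
  obtain ⟨F₀, hF₀⟩ := h4.exists
  refine h2.of_nonneg_of_le_compl F₀ (fun k θ hθ => mul_nonneg (hx k θ hθ).le (hc k θ hθ))
    fun k hk θ hθ => mul_le_add_log_mul_sq (hx k θ hθ) ?_ (hc k θ hθ)
  have h5 := hF₀ θ hθ
  rw [Real.dist_eq] at h5
  -- A single term outside `F₀` is at most the remainder after `F₀`, so it is below `1/e`.
  have h6 := sum_le_hasSum (insert k F₀) (fun j _ => (hx j θ hθ).le) (hx1 θ hθ)
  rw [Finset.sum_insert hk] at h6
  linarith [le_abs_self (1 - ∑ i ∈ F₀, x i θ)]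

end Series

/-! ### Eigenvalues of a state and matrix elements of the series. -/

section EigenBasis

open Filter Topology

variable {𝓗 : Type*} [NormedAddCommGroup 𝓗] [InnerProductSpace ℂ 𝓗] [CompleteSpace 𝓗] {ι : Type*}

theorem IsState.eigenvalue_nonneg {T : TraceClass 𝓗} (hT : IsState T) {v : 𝓗} (hv : ‖v‖ = 1)
    {μ : ℝ} (h : TraceClass.toCLM T v = (μ : ℂ) • v) : 0 ≤ μ := by
  have h1 := hT.nonneg.re_inner_nonneg_right v
  rw [h, inner_smul_right, inner_self_eq_norm_sq_to_K, hv] at h1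
  simpa using h1

/-- The eigenvalues of a state sum to one. -/
theorem IsState.hasSum_eigenvalues {T : TraceClass 𝓗} (hT : IsState T) (b : HilbertBasis ι ℂ 𝓗)
    {lam : ι → ℝ} (h : ∀ k, TraceClass.toCLM T (b k) = (lam k : ℂ) • b k) : HasSum lam 1 := by
  have habs : CFC.abs (TraceClass.toCLM T) = TraceClass.toCLM T :=
    CFC.abs_of_nonneg _ ((ContinuousLinearMap.nonneg_iff_isPositive _).2 hT.nonneg)
  have hfin := T.traceAbs_lt_top
  have hstd : traceAbs (stdBasis 𝓗) (TraceClass.toCLM T) = 1 := by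
    rw [traceAbs, habs] at hfin ⊢
    have hs : Summable fun i => ‖⟪stdBasis 𝓗 i, TraceClass.toCLM T (stdBasis 𝓗 i)⟫_ℂ‖ := by
      have := ENNReal.summable_toReal hfin.ne
      simpa using this
    have hre : ∀ i, ⟪stdBasis 𝓗 i, TraceClass.toCLM T (stdBasis 𝓗 i)⟫_ℂ =
        ((‖⟪stdBasis 𝓗 i, TraceClass.toCLM T (stdBasis 𝓗 i)⟫_ℂ‖ : ℝ) : ℂ) := fun i =>
      Complex.eq_coe_norm_of_nonneg (hT.nonneg.inner_nonneg_right _)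
    have h1 := hT.trace_eq_one
    rw [TraceClass.trace, tsum_congr hre, ← Complex.ofReal_tsum] at h1
    simp only [← ofReal_norm]
    rw [← ENNReal.ofReal_tsum_of_nonneg (fun _ => norm_nonneg _) hs, Complex.ofReal_eq_one.1 h1,
      ENNReal.ofReal_one]
  have hl : ∀ k, 0 ≤ lam k := fun k => hT.eigenvalue_nonneg (b.orthonormal.1 k) (h k)
  -- Since `|T| = T`, basis independence of `Tr |T|` carries the normalisation from `stdBasis` to
  -- the eigenbasis.
  rw [traceAbs_basis_indep _ b, traceAbs, habs] at hstd
  have h2 : ∀ k, ‖⟪b k, TraceClass.toCLM T (b k)⟫_ℂ‖ₑ = ENNReal.ofReal (lam k) := by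
    intro k
    rw [h, inner_smul_right, inner_self_eq_norm_sq_to_K, b.orthonormal.1 k, ← ofReal_norm]
    simp [abs_of_nonneg (hl k)]
  rw [tsum_congr h2] at hstd
  have h3 := ENNReal.hasSum_toReal (f := fun k => ENNReal.ofReal (lam k)) (by simp [hstd])
  rw [← ENNReal.tsum_toReal_eq (fun _ => ENNReal.ofReal_ne_top), hstd, ENNReal.toReal_one] at h3
  simpa only [ENNReal.toReal_ofReal (hl _)] using h3

section Matrix

variable (b : HilbertBasis ι ℂ 𝓗)

/-- The derivative of a rank one projection onto a unit vector `u` moving with velocity `v`. -/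
noncomputable def projDeriv (u v : 𝓗) : TraceClass 𝓗 :=
  TraceClass.rankOne u v + TraceClass.rankOne v u

theorem norm_projDeriv_le (u v : 𝓗) : ‖projDeriv u v‖ ≤ 2 * (‖u‖ * ‖v‖) := by
  refine (norm_add_le _ _).trans ?_
  have h1 := TraceClass.norm_rankOne_le u v
  have h2 := TraceClass.norm_rankOne_le v u
  rw [mul_comm] at h2
  linarith

theorem toCLM_real_smul_apply (c : ℝ) (T : TraceClass 𝓗) (f : 𝓗) :
    TraceClass.toCLM (c • T) f = (c : ℂ) • TraceClass.toCLM T f := by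
  rw [show c • T = (c : ℂ) • T from rfl, map_smul, smul_apply]

theorem toCLM_projDeriv_apply (u v f : 𝓗) :
    TraceClass.toCLM (projDeriv u v) f = ⟪v, f⟫_ℂ • u + ⟪u, f⟫_ℂ • v := by
  rw [projDeriv, map_add, add_apply, TraceClass.toCLM_rankOne_apply,
    TraceClass.toCLM_rankOne_apply]

/-- The matrix elements of `∑ₖ cₖ (bₖ dₖ* + dₖ bₖ*)`. -/
theorem inner_of_hasSum_smul_projDeriv {c : ι → ℝ} {d : ι → 𝓗} {x : 𝓗} (j k : ι)
    (h : HasSum (fun m => (c m : ℂ) • TraceClass.toCLM (projDeriv (b m) (d m)) (b k)) x) :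
    ⟪b j, x⟫_ℂ = c j * ⟪d j, b k⟫_ℂ + c k * ⟪b j, d k⟫_ℂ := by
  refine (h.mapL (innerSL ℂ (b j))).unique ?_
  -- Orthonormality leaves only `m = j` from the terms `bₘ dₘ*` and only `m = k` from `dₘ bₘ*`.
  have h1 := (hasSum_mul_inner_basis_left b (fun m => (c m : ℂ) * ⟪d m, b k⟫_ℂ) j).add
    (hasSum_mul_inner_basis_right b (fun m => (c m : ℂ) * ⟪b j, d m⟫_ℂ) k)
  refine h1.congr_fun fun m => ?_
  rw [toCLM_projDeriv_apply, innerSL_apply_apply, inner_smul_right, inner_add_right,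
    inner_smul_right, inner_smul_right]
  ring

/-- The matrix elements of `∑ₖ cₖ bₖ bₖ*`. -/
theorem inner_of_hasSum_smul_rankOne {c : ι → ℝ} {x : 𝓗} (j k : ι)
    (h : HasSum (fun m => (c m : ℂ) • TraceClass.toCLM (TraceClass.rankOne (b m) (b m)) (b k)) x) :
    ⟪b j, x⟫_ℂ = c k * ⟪b j, b k⟫_ℂ := by
  refine (h.mapL (innerSL ℂ (b j))).unique ?_
  refine (hasSum_mul_inner_basis_right b (fun m => (c m : ℂ) * ⟪b j, b m⟫_ℂ) k).congr_fun
    fun m => ?_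
  rw [TraceClass.toCLM_rankOne_apply, innerSL_apply_apply, inner_smul_right, inner_smul_right]
  ring

end Matrix

end EigenBasis

/-! ### The logarithmic derivative and the Kubo–Mori–Bogoliubov equation. -/

section LogarithmicDerivative

open Filter Topology

variable {𝓗 : Type*} [NormedAddCommGroup 𝓗] [InnerProductSpace ℂ 𝓗] [CompleteSpace 𝓗] {ι : Type*}

/-- An operator with the matrix elements of `∑ₖ μₖ bₖ bₖ* + ∑ₖ λₖ (bₖ dₖ* + dₖ bₖ*)` is this sum. -/
theorem eq_tsum_rankOne_add_tsum_projDeriv (b : HilbertBasis ι ℂ 𝓗) {lam mu : ι → ℝ} {d : ι → 𝓗}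
    {R : TraceClass 𝓗}
    (h₁ : Summable fun k => mu k • TraceClass.rankOne (b k) (b k))
    (h₂ : Summable fun k => lam k • projDeriv (b k) (d k))
    (hR : ∀ j k, ⟪b j, TraceClass.toCLM R (b k)⟫_ℂ =
      mu k * ⟪b j, b k⟫_ℂ + (lam j * ⟪d j, b k⟫_ℂ + lam k * ⟪b j, d k⟫_ℂ)) :
    R = (∑' k, mu k • TraceClass.rankOne (b k) (b k)) +
      ∑' k, lam k • projDeriv (b k) (d k) := by
  refine TraceClass.toCLM_injective (eq_of_forall_matrix b fun j k => ?_)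
  -- Evaluation at `b k` is continuous in trace norm, so the series may be evaluated term by term.
  have h₁' := h₁.hasSum.mapL ((ContinuousLinearMap.apply ℂ 𝓗 (b k)).comp TraceClass.toCLML)
  have h₂' := h₂.hasSum.mapL ((ContinuousLinearMap.apply ℂ 𝓗 (b k)).comp TraceClass.toCLML)
  simp only [ContinuousLinearMap.comp_apply, ContinuousLinearMap.apply_apply,
    TraceClass.toCLML_apply, toCLM_real_smul_apply] at h₁' h₂'
  rw [map_add, add_apply, inner_add_right, inner_of_hasSum_smul_rankOne b j k h₁',
    inner_of_hasSum_smul_projDeriv b j k h₂', hR]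

/-- The Boltzmann-von Neumann logarithmic derivative. -/
theorem exists_logarithmicDerivative (b : HilbertBasis ι ℂ 𝓗) {c l : ι → ℝ} {d : ι → 𝓗}
    (hc : BddAbove (Set.range fun k => |c k|))
    (hl : Summable fun k => (|l k| * ‖d k‖) ^ 2) :
    ∃ H₁ H₂ : 𝓗 →L[ℂ] 𝓗,
      (∀ f, HasSum (fun k => (c k : ℂ) •
        TraceClass.toCLM (TraceClass.rankOne (b k) (b k)) f) (H₁ f)) ∧
      (∀ f, HasSum (fun k => (l k : ℂ) • TraceClass.toCLM (projDeriv (b k) (d k)) f) (H₂ f)) ∧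
      ‖H₁ + H₂‖ ≤ (⨆ k, |c k|) + 2 * √(∑' k, (|l k| * ‖d k‖) ^ 2) := by
  obtain ⟨H₁, h₁, hn₁⟩ := exists_hasSum_diagonal b c (Real.iSup_nonneg fun k => abs_nonneg (c k))
    (le_ciSup hc)
  -- The real weight is absorbed into the vector, splitting the series into the sums of `bₖ vₖ*` and
  -- `vₖ bₖ*` with `vₖ = lₖ dₖ`.
  have hv : ∀ k, ‖(l k : ℂ) • d k‖ ^ 2 = (|l k| * ‖d k‖) ^ 2 := fun k => by
    rw [norm_smul, Complex.norm_real, Real.norm_eq_abs]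
  have hvs : Summable fun k => ‖(l k : ℂ) • d k‖ ^ 2 := by simpa only [hv] using hl
  obtain ⟨A, hA, hnA⟩ := exists_hasSum_inner_smul_basis b hvs
  obtain ⟨B, hB, hnB⟩ := exists_hasSum_inner_basis_smul b hvs
  simp only [hv] at hnA hnB
  refine ⟨H₁, A + B, fun f => ?_, fun f => ?_, ?_⟩
  · refine (h₁ f).congr_fun fun k => ?_
    rw [TraceClass.toCLM_rankOne_apply, smul_smul]
  · refine ((hA f).add (hB f)).congr_fun fun k => ?_
    rw [toCLM_projDeriv_apply, inner_smul_left, Complex.conj_ofReal, smul_add, smul_smul,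
      smul_comm]
  · refine (norm_add_le _ _).trans (add_le_add hn₁ ((norm_add_le _ _).trans ?_))
    linarith

/-- The Kubo-Mori-Bogoliubov equation. -/
theorem eq_integral_rpow_mul_logarithmicDerivative_mul_rpow (b : HilbertBasis ι ℂ 𝓗)
    {lam mu : ι → ℝ} {d : ι → 𝓗} {a R H₁ H₂ : 𝓗 →L[ℂ] 𝓗} (ha : 0 ≤ a) (hlam : ∀ k, 0 < lam k)
    (hab : ∀ k, a (b k) = (lam k : ℂ) • b k)
    (hd : ∀ j k, ⟪b j, d k⟫_ℂ + ⟪d j, b k⟫_ℂ = 0)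
    (hR : ∀ j k, ⟪b j, R (b k)⟫_ℂ =
      mu k * ⟪b j, b k⟫_ℂ + (lam j * ⟪d j, b k⟫_ℂ + lam k * ⟪b j, d k⟫_ℂ))
    (h₁ : ∀ f, HasSum (fun k => ((mu k / lam k : ℝ) : ℂ) •
        TraceClass.toCLM (TraceClass.rankOne (b k) (b k)) f) (H₁ f))
    (h₂ : ∀ f, HasSum (fun k => (Real.log (lam k) : ℂ) •
        TraceClass.toCLM (projDeriv (b k) (d k)) f) (H₂ f)) :
    R = ∫ t in (0 : ℝ)..1, a ^ t * (H₁ + H₂) * a ^ (1 - t) := by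
  refine eq_of_forall_matrix b fun j k => ?_
  rw [inner_integral_rpow_mul_mul_rpow ha _ (hab j) (hab k), add_apply, inner_add_right,
    inner_of_hasSum_smul_rankOne b j k (h₁ _), inner_of_hasSum_smul_projDeriv b j k (h₂ _), hR,
    eq_neg_of_add_eq_zero_right (hd j k)]
  -- On the diagonal the `d` terms cancel and the integral is `λⱼ`. Off it the `mu` term vanishes
  -- and the logarithmic mean identity applies.
  rcases eq_or_ne j k with rfl | hjk
  · rw [integral_rpow_mul_rpow_self (hlam j)]
    have h0 : (lam j : ℂ) ≠ 0 := Complex.ofReal_ne_zero.2 (hlam j).ne'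
    push_cast
    field_simp
    ring
  · rw [b.orthonormal.2 hjk]
    have h := congrArg (Complex.ofReal) (integral_rpow_mul_rpow_mul_log (hlam j) (hlam k))
    rw [Complex.ofReal_mul, Complex.ofReal_sub, Complex.ofReal_sub] at h
    linear_combination -⟪b j, d k⟫_ℂ * h

section Derivatives

theorem inner_add_inner_eq_zero_of_orthonormal {𝓗 : Type*} [NormedAddCommGroup 𝓗]
    [InnerProductSpace ℂ 𝓗] {I : Set ℝ} {e : ι → ℝ → 𝓗} {θ : ℝ} (hθ : θ ∈ I) (hu : UniqueDiffWithinAt ℝ I θ)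
    (ho : ∀ s ∈ I, Orthonormal ℂ fun k => e k s) {j k : ι} {u v : 𝓗}
    (hj : HasDerivWithinAt (e j) u I θ) (hk : HasDerivWithinAt (e k) v I θ) :
    ⟪e j θ, v⟫_ℂ + ⟪u, e k θ⟫_ℂ = 0 := by
  classical
  have h1 := hj.inner ℂ hk
  have hc : ∀ s ∈ I, ⟪e j s, e k s⟫_ℂ = if j = k then 1 else 0 := fun s hs =>
    orthonormal_iff_ite.1 (ho s hs) j k
  have h2 : HasDerivWithinAt (fun s => ⟪e j s, e k s⟫_ℂ) 0 I θ :=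
    (hasDerivWithinAt_const θ I (if j = k then (1 : ℂ) else 0)).congr hc (hc θ hθ)
  exact hu.eq_deriv _ h1 h2

variable {I : Set ℝ} {ρ : ℝ → TraceClass 𝓗} {lam : ι → ℝ → ℝ} {e : ι → ℝ → 𝓗} {θ : ℝ}

/-- Evaluation of trace class operators at vectors, as a bounded real bilinear map. -/
noncomputable def TraceClass.evalL : TraceClass 𝓗 →L[ℝ] 𝓗 →L[ℝ] 𝓗 :=
  (ContinuousLinearMap.restrictScalarsL ℂ 𝓗 𝓗 ℝ ℝ).comp
    ((TraceClass.toCLML (𝓗 := 𝓗)).restrictScalars ℝ)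

@[simp] theorem TraceClass.evalL_apply (T : TraceClass 𝓗) (f : 𝓗) :
    TraceClass.evalL T f = TraceClass.toCLM T f := rfl

/-- Differentiate `ρ eₖ = λₖ eₖ` by the product rule, pair with `eⱼ`, and move `ρ` onto `eⱼ` by
symmetry. The relation `huv` then brings the result into the form of the entries of the two series.
-/
theorem inner_deriv_apply_of_eigen (hθ : θ ∈ I) (hu : UniqueDiffWithinAt ℝ I θ)
    (hpos : (TraceClass.toCLM (ρ θ)).IsPositive)
    (heig : ∀ s ∈ I, ∀ k, TraceClass.toCLM (ρ s) (e k s) = (lam k s : ℂ) • e k s) {R : TraceClass 𝓗}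
    {j k : ι} {u v : 𝓗} {m : ℝ} (hR : HasDerivWithinAt ρ R I θ)
    (hv : HasDerivWithinAt (e k) v I θ) (hm : HasDerivWithinAt (lam k) m I θ)
    (huv : ⟪e j θ, v⟫_ℂ + ⟪u, e k θ⟫_ℂ = 0) :
    ⟪e j θ, TraceClass.toCLM R (e k θ)⟫_ℂ = m * ⟪e j θ, e k θ⟫_ℂ +
      (lam j θ * ⟪u, e k θ⟫_ℂ + lam k θ * ⟪e j θ, v⟫_ℂ) := by
  have h1 : HasDerivWithinAt (fun s => TraceClass.toCLM (ρ s) (e k s))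
      (TraceClass.toCLM (ρ θ) v + TraceClass.toCLM R (e k θ)) I θ :=
    TraceClass.evalL.hasDerivWithinAt_of_bilinear hR hv
  have h2 : HasDerivWithinAt (fun s => TraceClass.toCLM (ρ s) (e k s))
      (lam k θ • v + m • e k θ) I θ :=
    (hm.smul hv).congr (fun s hs => heig s hs k) (heig θ hθ k)
  have h3 := congrArg (fun x => ⟪e j θ, x⟫_ℂ) (hu.eq_deriv _ h1 h2)
  have h4 : ⟪e j θ, TraceClass.toCLM (ρ θ) v⟫_ℂ = lam j θ * ⟪e j θ, v⟫_ℂ := by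
    refine (hpos.isSymmetric (e j θ) v).symm.trans ?_
    change ⟪TraceClass.toCLM (ρ θ) (e j θ), v⟫_ℂ = _
    rw [heig θ hθ j, inner_smul_left, Complex.conj_ofReal]
  have h5 : ∀ (c : ℝ) (x : 𝓗), ⟪e j θ, c • x⟫_ℂ = c * ⟪e j θ, x⟫_ℂ := fun c x =>
    inner_smul_right _ _ (c : ℂ)
  simp only [inner_add_right, h4, h5] at h3
  linear_combination h3 - lam j θ * huv

theorem IsSpectralDecomposition.eigenvalue_pos (hρ : IsAnalyticStateFamily I ρ)
    (hspec : IsSpectralDecomposition I ρ lam e) (hθ : θ ∈ I) (k : ι) : 0 < lam k θ := by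
  have h1 := (hspec.orthonormal θ hθ).1 k
  refine lt_of_le_of_ne ((hρ.isState θ hθ).eigenvalue_nonneg h1 (hspec.eigen θ hθ k)) fun h0 => ?_
  have h2 := hspec.eigen θ hθ k
  rw [← h0, Complex.ofReal_zero, zero_smul] at h2
  have h3 := hρ.ker_eq_bot θ hθ _ h2
  simp [h3] at h1

theorem IsSpectralDecomposition.exists_hilbertBasis (hspec : IsSpectralDecomposition I ρ lam e)
    (hθ : θ ∈ I) : ∃ b : HilbertBasis ι ℂ 𝓗, ∀ k, b k = e k θ :=
  ⟨HilbertBasis.mk (hspec.orthonormal θ hθ) (hspec.total θ hθ).ge, fun k => by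
    rw [HilbertBasis.coe_mk]⟩

end Derivatives

end LogarithmicDerivative

end QuantumLD

/-! ### The main theorem. -/

theorem theorem3p6 {𝓗 : Type*} [NormedAddCommGroup 𝓗] [InnerProductSpace ℂ 𝓗] [CompleteSpace 𝓗]
    [TopologicalSpace.SeparableSpace 𝓗] (hdim : ¬ FiniteDimensional ℂ 𝓗) {ι : Type*}
    -- a non-degenerate interval, open or not; derivatives are taken within it
    (I : Set ℝ) (hI : I.OrdConnected) (hI' : (interior I).Nonempty)
    (ρ : ℝ → TraceClass 𝓗) (lam : ι → ℝ → ℝ) (e : ι → ℝ → 𝓗)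
    (hρ : IsAnalyticStateFamily I ρ) (hspec : IsSpectralDecomposition I ρ lam e) :
    (∀ θ ∈ I,
      BddAbove (Set.range fun k => |derivWithin (lam k) I θ / lam k θ|) →
      Summable (fun k => (|Real.log (lam k θ)| * ‖derivWithin (e k) I θ‖) ^ 2) →
      -- (i), all sums of operators being taken in the trace norm
      (Summable (fun k => |derivWithin (lam k) I θ|) ∧
        Summable (fun k => lam k θ * ‖derivWithin (e k) I θ‖) ∧
        DifferentiableWithinAt ℝ ρ I θ ∧
        (∀ k, DifferentiableWithinAt ℝ (eigenProj e k) I θ) ∧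
        Summable (fun k => derivWithin (lam k) I θ • eigenProj e k θ) ∧
        Summable (fun k => lam k θ • derivWithin (eigenProj e k) I θ) ∧
        derivWithin ρ I θ = (∑' k, derivWithin (lam k) I θ • eigenProj e k θ) +
          (∑' k, lam k θ • derivWithin (eigenProj e k) I θ)) ∧
      -- (ii)
      (∀ f : 𝓗, HasDerivWithinAt (fun s => (ρ s : 𝓗 →L[ℂ] 𝓗) f)
        (TraceClass.toCLM (derivWithin ρ I θ) f) I θ) ∧
      ∃ H H₁ H₂ : 𝓗 →L[ℂ] 𝓗,
        (∀ f : 𝓗, HasSum (fun k => (derivWithin (lam k) I θ / lam k θ) •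
          (eigenProj e k θ : 𝓗 →L[ℂ] 𝓗) f) (H₁ f)) ∧
        (∀ f : 𝓗, HasSum (fun k => Real.log (lam k θ) •
          TraceClass.toCLM (derivWithin (eigenProj e k) I θ) f) (H₂ f)) ∧
        H = H₁ + H₂ ∧
        ‖H‖ ≤ (⨆ k, |derivWithin (lam k) I θ / lam k θ|) +
          2 * √(∑' k, (|Real.log (lam k θ)| * ‖derivWithin (e k) I θ‖) ^ 2) ∧
        -- (iii)
        IntervalIntegrable
          (fun t : ℝ => (ρ θ : 𝓗 →L[ℂ] 𝓗) ^ t * H * (ρ θ : 𝓗 →L[ℂ] 𝓗) ^ (1 - t))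
          MeasureTheory.volume 0 1 ∧
        TraceClass.toCLM (derivWithin ρ I θ) =
          ∫ t in (0 : ℝ)..1, (ρ θ : 𝓗 →L[ℂ] 𝓗) ^ t * H * (ρ θ : 𝓗 →L[ℂ] 𝓗) ^ (1 - t)) ∧
    -- (i), uniformly in the parameter
    (∀ K ⊆ I, IsCompact K →
      SummableUniformlyOn
        (fun k θ => (|Real.log (lam k θ)| * ‖derivWithin (e k) I θ‖) ^ 2) K →
      SummableUniformlyOn (fun k θ => lam k θ * ‖derivWithin (e k) I θ‖) K) := by
  -- Non-degeneracy of the interval makes derivatives within it unique, end points included.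
  have hu : ∀ θ ∈ I, UniqueDiffWithinAt ℝ I θ :=
    uniqueDiffOn_convex hI.convex hI'
  refine ⟨fun θ hθ hbdd hsq => ?_, fun K hK hKc hs => ?_⟩
  · obtain ⟨b, hb⟩ := hspec.exists_hilbertBasis hθ
    have hst := hρ.isState θ hθ
    have hpos : 0 ≤ TraceClass.toCLM (ρ θ) :=
      (ContinuousLinearMap.nonneg_iff_isPositive _).2 hst.nonneg
    have hlam : ∀ k, 0 < lam k θ := hspec.eigenvalue_pos hρ hθ
    have heig : ∀ k, TraceClass.toCLM (ρ θ) (b k) = (lam k θ : ℂ) • b k := fun k => by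
      rw [hb]; exact hspec.eigen θ hθ k
    have hsum := hst.hasSum_eigenvalues b heig
    have hρd : DifferentiableWithinAt ℝ ρ I θ := by
      simpa [Set.insert_eq_of_mem hθ] using (hρ.analytic θ hθ).differentiableWithinAt
    have hed := fun k => (hspec.differentiable_e k θ hθ).hasDerivWithinAt
    have hld := fun k => (hspec.differentiable_lam k θ hθ).hasDerivWithinAt
    have hPd := fun k => hasDerivWithinAt_eigenProj (hed k)
    have hP : ∀ k, eigenProj e k θ = TraceClass.rankOne (b k) (b k) := fun k => by
      rw [hb]; rfl
    have hP' : ∀ k, derivWithin (eigenProj e k) I θ =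
        projDeriv (b k) (derivWithin (e k) I θ) := fun k => by
      rw [hb]; exact (hPd k).derivWithin (hu θ hθ)
    have hanti : ∀ j k, ⟪b j, derivWithin (e k) I θ⟫_ℂ + ⟪derivWithin (e j) I θ, b k⟫_ℂ = 0 :=
      fun j k => by
        rw [hb, hb]
        exact inner_add_inner_eq_zero_of_orthonormal hθ (hu θ hθ) hspec.orthonormal (hed j) (hed k)
    have hR : ∀ j k, ⟪b j, TraceClass.toCLM (derivWithin ρ I θ) (b k)⟫_ℂ =
        derivWithin (lam k) I θ * ⟪b j, b k⟫_ℂ + (lam j θ * ⟪derivWithin (e j) I θ, b k⟫_ℂ +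
          lam k θ * ⟪b j, derivWithin (e k) I θ⟫_ℂ) := fun j k => by
      have := hanti j k
      rw [hb, hb] at this ⊢
      exact inner_deriv_apply_of_eigen hθ (hu θ hθ) hst.nonneg hspec.eigen hρd.hasDerivWithinAt
        (hed k) (hld k) this
    obtain ⟨M, hM⟩ := hbdd
    have hmu : Summable fun k => |derivWithin (lam k) I θ| := by
      -- The bound on the logarithmic derivatives reads `|λₖ'| ≤ M λₖ`, and the eigenvalues are
      -- summable.
      refine (hsum.summable.mul_left M).of_nonneg_of_le (fun _ => abs_nonneg _) fun k => ?_
      have h := hM ⟨k, rfl⟩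
      simpa only [abs_div, abs_of_pos (hlam k), div_le_iff₀ (hlam k)] using h
    have hle := summable_mul_of_summable_log_mul_sq hlam
      (fun k => norm_nonneg (derivWithin (e k) I θ)) hsum.summable hsq
    have hS₁ : Summable fun k => derivWithin (lam k) I θ • TraceClass.rankOne (b k) (b k) := by
      refine Summable.of_norm_bounded hmu fun k => ?_
      rw [norm_smul, Real.norm_eq_abs]
      refine mul_le_of_le_one_right (abs_nonneg _) ((TraceClass.norm_rankOne_le _ _).trans ?_)
      rw [b.orthonormal.1 k, one_mul]
    have hS₂ : Summable fun k => lam k θ • projDeriv (b k) (derivWithin (e k) I θ) := by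
      refine Summable.of_norm_bounded (hle.mul_left 2) fun k => ?_
      rw [norm_smul, Real.norm_of_nonneg (hlam k).le]
      have h := norm_projDeriv_le (b k) (derivWithin (e k) I θ)
      rw [b.orthonormal.1 k, one_mul] at h
      calc _ ≤ lam k θ * (2 * ‖derivWithin (e k) I θ‖) := by gcongr; exact (hlam k).le
        _ = _ := by ring
    obtain ⟨H₁, H₂, hH₁, hH₂, hn⟩ := exists_logarithmicDerivative b ⟨M, hM⟩ hsq
    refine ⟨⟨hmu, hle, hρd, fun k => (hPd k).differentiableWithinAt, ?_, ?_, ?_⟩, fun f => ?_,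
      H₁ + H₂, H₁, H₂, fun f => ?_, fun f => ?_, rfl, hn,
      intervalIntegrable_rpow_mul_mul_rpow hpos _, ?_⟩
    · simpa only [hP] using hS₁
    · simpa only [hP'] using hS₂
    · simp only [hP, hP']
      exact eq_tsum_rankOne_add_tsum_projDeriv b hS₁ hS₂ hR
    · have h := TraceClass.evalL.hasDerivWithinAt_of_bilinear hρd.hasDerivWithinAt
        (hasDerivWithinAt_const θ I f)
      simpa using h
    · simp only [hP]
      exact hH₁ f
    · simp only [hP']
      exact hH₂ f
    · exact eq_integral_rpow_mul_logarithmicDerivative_mul_rpow b hpos hlam heig hanti hR hH₁ hH₂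
  · refine summableUniformlyOn_mul_of_log_mul_sq hKc
      (fun k θ hθ => hspec.eigenvalue_pos hρ (hK hθ) k)
      (fun k => (hspec.differentiable_lam k).continuousOn.mono hK) (fun θ hθ => ?_)
      (fun _ _ _ => norm_nonneg _) hs
    obtain ⟨b, hb⟩ := hspec.exists_hilbertBasis (hK hθ)
    exact (hρ.isState θ (hK hθ)).hasSum_eigenvalues b fun k => by
      rw [hb]; exact hspec.eigen θ (hK hθ) k
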